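/- Consider a downlink cellular network with $T$ tiers of base stations (BSs). The BSs of tier $q$ form a homogeneous Poisson point process in $\mathbb{R}^2$ of density $\lambda_q=\kappa_q\lambda$, the tiers being independent; they transmit with power $P_q=\chi_q p$, have biasing factor $B_q$, and share $F_B^{(q)}\in\{1,2,\dots\}$ frequency bands; all of $\kappa_q,\chi_q,\lambda,p,B_q$ are positive. All tiers have the same path-loss exponent $\alpha>2$. The power gains of all links are nonnegative with mean $1$; the gains of the interfering BSs of tier $q$ are i.i.d. with the law of $g_{q,I}$, the gain of the serving BS, if it is in tier $t$, is independent of the interfering network and has the law of $g_{t,0}$. Each interfering BS picks one of the bands of its tier uniformly and independently, and interferes only if it picks the band used by the mobile terminal, so that BSs of tier $q$ interfere with probability $1/F_B^{(q)}$. The noise power is $\sigma_N^2\ge 0$, $\mathrm{SNR}=p/\sigma_N^2$ and $\mathrm{SNR}_q=P_q/\sigma_N^2=\chi_q\,\mathrm{SNR}$. The terminal, at the origin, is served by the nearest BS of the tier $t$ that maximizes $P_t d_t^{-\alpha}B_t$, where $d_t$ is the distance of the nearest BS of tier $t$. Put $\rho_{t,q}=\frac{P_q}{P_t}\frac{B_q}{B_t}$.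 The contribution of tier $t$ to the average rate is $$\tilde{\mathcal R}_t=2\pi\lambda_t\int_0^\infty \xi\exp\Big\{-\pi\sum_{q=1}^T\lambda_q\rho_{t,q}^{2/\alpha}\xi^2\Big\}\frac1{F_B^{(t)}}\,\mathbb E\Big\{\ln\Big(1+\frac{P_t g_{t,0}\xi^{-\alpha}}{\sigma_N^2+I_{\rm agg}(\xi)}\Big)\Big\}d\xi ,$$ where $I_{\rm agg}(\xi)$ is the sum of $P_q g\,d^{-\alpha}$ over all BSs, of all tiers $q$, that interfere and whose distance $d$ exceeds $\rho_{t,q}^{1/\alpha}\xi$ ($g$ denotes the gain of the BS). Let $\mathcal M_{t,0}(s)=\mathbb E\,e^{-s g_{t,0}}$, $\mathcal M_{q,I}(s)=\mathbb E\,e^{-s g_{q,I}}$, $$\mathcal T_{q,I}(y)=\Gamma\big(1-\tfrac2\alpha\big)\sum_{k=0}^\infty \frac{y^{k+1}\,\mathbb E\{g_{q,I}^{k+1}e^{-y g_{q,I}}\}}{\Gamma(2-\frac2\alpha+k)},$$ $$\tilde{\mathcal Z}_t(z)=\sum_{q=1}^T\frac{\kappa_q}{F_B^{(q)}}\frac{F_B^{(t)}}{\kappa_t}\,\rho_{t,q}^{2/\alpha}\Big[(F_B^{(q)}-1)+\mathcal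 M_{q,I}\Big(\rho_{t,q}^{-1}\tfrac{\mathrm{SNR}_q}{\mathrm{SNR}_t}z\Big)+\mathcal T_{q,I}\Big(\rho_{t,q}^{-1}\tfrac{\mathrm{SNR}_q}{\mathrm{SNR}_t}z\Big)\Big],$$ where $\mathrm{SNR}_q/\mathrm{SNR}_t=\chi_q/\chi_t$. Then, for every tier $t$, the series converges for $y>0$, the integrals below converge, $\tilde{\mathcal R}_t$ is finite, and: (i) the interference-limited rate $\tilde{\mathcal R}_t^{(\mathrm{SNR}_\infty)}$, i.e. $\tilde{\mathcal R}_t$ at $\sigma_N^2=0$, which is also its limit as $\sigma_N^2\to0^+$ ($\mathrm{SNR}\to\infty$), equals the dense-network limit $\tilde{\mathcal R}_t^{(\lambda_\infty)}=\lim_{\lambda\to\infty}\tilde{\mathcal R}_t$ (for any fixed $\sigma_N^2\ge0$), both being $$\int_0^\infty\frac{1-\mathcal M_{t,0}(z)}{\tilde{\mathcal Z}_t(z)}\frac{dz}{z},$$ and $\tilde{\mathcal R}_t\le\tilde{\mathcal R}_t^{(\mathrm{SNR}_\infty)}$ for all $\lambda>0$ and $\sigma_N^2\ge0$; (ii) for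 small non-zero noise, $\tilde{\mathcal R}_t$ is approximated by $$\tilde{\mathcal R}_t^{(\mathrm{SNR}\gg1)}=\tilde{\mathcal R}_t^{(\mathrm{SNR}_\infty)}-\Big(\pi\frac{\lambda_t}{F_B^{(t)}}\Big)^{-\alpha/2}\Gamma\big(1+\tfrac\alpha2\big)\frac1{\mathrm{SNR}_t}\int_0^\infty\frac{1-\mathcal M_{t,0}(z)}{\tilde{\mathcal Z}_t(z)^{1+\alpha/2}}\,dz$$ in the sense that $\tilde{\mathcal R}_t^{(\mathrm{SNR}\gg1)}\le\tilde{\mathcal R}_t$ for all $\lambda,\sigma_N^2>0$ and, for every fixed $\lambda>0$, $\tilde{\mathcal R}_t-\tilde{\mathcal R}_t^{(\mathrm{SNR}\gg1)}=o(1/\mathrm{SNR})$ as $\sigma_N^2\to0^+$. -/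

import Mathlib

open MeasureTheory ProbabilityTheory Set Filter Topology Asymptotics
open scoped ENNReal NNReal

noncomputable section

/-- The Euclidean plane in which the base stations (BSs) live. The mobile terminal is at `0`. -/
abbrev Plane : Type := EuclideanSpace ℝ (Fin 2)

/-- `ν` is the law of a power channel gain: a nonnegative random variable of mean one. -/
structure IsFadingLaw (ν : Measure ℝ) : Prop where
  isProb : IsProbabilityMeasure ν
  nonneg : ∀ᵐ x ∂ν, 0 ≤ x
  integrable : Integrable (fun x : ℝ => x) ν
  mean_one : ∫ x, x ∂ν = 1

/-- Parameters of a `T`-tier network with a common path-loss exponent `α`. Tier `t` has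
BS density `κ t * lam`, transmit power `χ t * p` (so that its signal-to-noise ratio
is `χ t * SNR` with `SNR = p / σ²`), biasing factor `B t`, number of frequency bands `F t`,
fading law `serving t` for the link of the serving BS and `interf t` for those of interferers. -/
structure MultiTier (T : ℕ) where
  α : ℝ
  κ : Fin T → ℝ
  χ : Fin T → ℝ
  B : Fin T → ℝ
  F : Fin T → ℕ
  serving : Fin T → Measure ℝ
  interf : Fin T → Measure ℝ
  two_lt_α : 2 < α
  κ_pos : ∀ t, 0 < κ t
  χ_pos : ∀ t, 0 < χ t
  B_pos : ∀ t, 0 < B t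
  one_le_F : ∀ t, 1 ≤ F t
  serving_law : ∀ t, IsFadingLaw (serving t)
  interf_law : ∀ t, IsFadingLaw (interf t)

/-- The points `X 0, X 1, …` form a homogeneous Poisson point process of intensity `r`
in the plane: numbers of points in disjoint Borel sets of finite area are independent
and Poisson distributed, with mean `r` times the area. -/
def IsPoissonProcess {Ω : Type*} [MeasurableSpace Ω] (P : Measure Ω)
    (X : ℕ → Ω → Plane) (r : ℝ) : Prop :=
  (∀ n, Measurable (X n)) ∧
  ∀ (m : ℕ) (A : Fin m → Set Plane) (k : Fin m → ℕ),
    (∀ i, MeasurableSet (A i)) → (∀ i, volume (A i) < ∞) →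
    (Pairwise fun i j => Disjoint (A i) (A j)) →
    P {ω | ∀ i, {n : ℕ | X n ω ∈ A i}.encard = (k i : ℕ∞)} =
      ∏ i, poissonMeasure (Real.toNNReal (r * (volume (A i)).toReal)) {k i}

/-- The random elements of a multi-tier deployment: positions `X q n`, power gains `G q n` and
frequency bands `band q n` of the BSs of each tier `q`, and the gain `g₀ t` of the
link to the serving BS when that BS is in tier `t`. -/
structure Deployment (T : ℕ) (F : Fin T → ℕ) (Ω : Type*) where
  X : Fin T → ℕ → Ω → Plane
  G : Fin T → ℕ → Ω → ℝ
  band : (q : Fin T) → ℕ → Ω → Fin (F q)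
  g₀ : Fin T → Ω → ℝ

namespace MultiTier

variable {T : ℕ}

/-- `D` realizes the network `S` with density parameter `lam`: each tier is a homogeneous Poisson
process of intensity `κ q * lam` with independent i.i.d. marks (gain, band), gains and bands being
independent and bands uniform; tiers are independent of each other; the
serving gain is independent of all this. -/
structure IsRealization (S : MultiTier T) (lam : ℝ) {Ω : Type*} [MeasurableSpace Ω]
    (P : Measure Ω) (D : Deployment T S.F Ω) : Prop where
  poisson : ∀ q, IsPoissonProcess P (D.X q) (S.κ q * lam)
  measurable_gain : ∀ q n, Measurable (D.G q n)
  gain_law : ∀ q n, P.map (D.G q n) = S.interf q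
  measurable_band : ∀ q n, Measurable (D.band q n)
  band_uniform : ∀ q n (j : Fin (S.F q)), P {ω | D.band q n ω = j} = (S.F q : ℝ≥0∞)⁻¹
  measurable_serving : ∀ t, Measurable (D.g₀ t)
  serving_gain_law : ∀ t, P.map (D.g₀ t) = S.serving t
  indep_gain_band : ∀ q n, IndepFun (D.G q n) (D.band q n) P
  iIndep_marks : ∀ q, iIndepFun (fun n ω => (D.G q n ω, D.band q n ω)) P
  indep_points_marks : ∀ q,
    IndepFun (fun ω n => D.X q n ω) (fun ω n => (D.G q n ω, D.band q n ω)) P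
  iIndep_tiers : iIndepFun (fun q ω n => (D.X q n ω, D.G q n ω, D.band q n ω)) P
  indep_serving : ∀ t,
    IndepFun (D.g₀ t) (fun ω q n => (D.X q n ω, D.G q n ω, D.band q n ω)) P

/-- The ratio `(P_q / P_t) (B_q / B_t)`. -/
def biasRatio (S : MultiTier T) (t q : Fin T) : ℝ := S.χ q / S.χ t * (S.B q / S.B t)

/-- Radius of the disc free of tier-`q` interferers, when the terminal is served by a BS of
tier `t` at distance `ξ`: the `r` with `P_q r^(-α) B_q = P_t ξ^(-α) B_t`. -/
def exclusionRadius (S : MultiTier T) (t q : Fin T) (ξ : ℝ) : ℝ :=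
  (S.biasRatio t q) ^ (1 / S.α) * ξ

/-- Aggregate interference given that the terminal is served by a BS of tier `t` at
distance `ξ`: a BS interferes if it lies outside the exclusion disc of its tier and has picked the
band used by the terminal (labelled `0` in each tier). -/
def interference (S : MultiTier T) (p : ℝ) (t : Fin T) (ξ : ℝ) {Ω : Type*}
    (D : Deployment T S.F Ω) (ω : Ω) : ℝ≥0∞ :=
  open Classical in
  ∑ q, ∑' n, if S.exclusionRadius t q ξ < ‖D.X q n ω‖ ∧ (D.band q n ω : ℕ) = 0 then
    ENNReal.ofReal (S.χ q * p * D.G q n ω * ‖D.X q n ω‖ ^ (-S.α)) else 0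

/-- Signal-to-interference-plus-noise ratio given service by tier `t` at distance `ξ`,
with noise power `σ2`. -/
def sinr (S : MultiTier T) (p σ2 : ℝ) (t : Fin T) (ξ : ℝ) {Ω : Type*}
    (D : Deployment T S.F Ω) (ω : Ω) : ℝ≥0∞ :=
  ENNReal.ofReal (S.χ t * p * D.g₀ t ω * ξ ^ (-S.α)) /
    (ENNReal.ofReal σ2 + S.interference p t ξ D ω)

/-- Average rate (in nats) given service by tier `t` at distance `ξ`; each of the `F t` bands
gives the fraction `1 / F t` of the rate. -/
def condRate (S : MultiTier T) (p σ2 : ℝ) (t : Fin T) (ξ : ℝ) {Ω : Type*} [MeasurableSpace Ω]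
    (P : Measure Ω) (D : Deployment T S.F Ω) : ℝ≥0∞ :=
  (S.F t : ℝ≥0∞)⁻¹ * ∫⁻ ω, ENNReal.ofReal (Real.log (1 + (S.sinr p σ2 t ξ D ω).toReal)) ∂P

/-- Contribution `R̃_t` of tier `t` to the average rate, i.e. the association probability of tier
`t` times the average rate conditioned on association to it. -/
def avgRate (S : MultiTier T) (lam p σ2 : ℝ) (t : Fin T) {Ω : Type*} [MeasurableSpace Ω]
    (P : Measure Ω) (D : Deployment T S.F Ω) : ℝ≥0∞ :=
  ∫⁻ ξ in Ioi (0 : ℝ),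
    ENNReal.ofReal (2 * Real.pi * (S.κ t * lam) * ξ *
      Real.exp (-(Real.pi * ∑ q, S.κ q * lam * S.biasRatio t q ^ (2 / S.α) * ξ ^ 2))) *
    S.condRate p σ2 t ξ P D

end MultiTier

/-- The moment generating function `E exp(-s g)` of a gain with law `ν`. -/
def mgfNeg (ν : Measure ℝ) (s : ℝ) : ℝ := ∫ x, Real.exp (-(s * x)) ∂ν

/-- Terms of the series `Tcal`. -/
def TcalTerm (α : ℝ) (ν : Measure ℝ) (y : ℝ) (k : ℕ) : ℝ :=
  y ^ (k + 1) * (∫ x, x ^ (k + 1) * Real.exp (-(y * x)) ∂ν) * (Real.Gamma (2 - 2 / α + k))⁻¹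

/-- `T(y) = Γ(1 - 2/α) ∑_k y^(k+1) E[g^(k+1) exp(-y g)] / Γ(2 - 2/α + k)`. -/
def Tcal (α : ℝ) (ν : Measure ℝ) (y : ℝ) : ℝ :=
  Real.Gamma (1 - 2 / α) * ∑' k : ℕ, TcalTerm α ν y k

namespace MultiTier

variable {T : ℕ}

/-- The denominator `∑_q (κ_q/F_q)(F_t/κ_t) (P_q B_q/(P_t B_t))^(2/α) [(F_q - 1) + M_q + T_q]`,
with `M_q` and `T_q` evaluated at `(P_q B_q/(P_t B_t))⁻¹ (SNR_q/SNR_t) z`. -/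
def Ztilde (S : MultiTier T) (t : Fin T) (z : ℝ) : ℝ :=
  ∑ q, (S.κ q / S.F q * (S.F t / S.κ t)) * S.biasRatio t q ^ (2 / S.α) *
    (((S.F q : ℝ) - 1) + mgfNeg (S.interf q) ((S.biasRatio t q)⁻¹ * (S.χ q / S.χ t) * z)
      + Tcal S.α (S.interf q) ((S.biasRatio t q)⁻¹ * (S.χ q / S.χ t) * z))

/-- Integrand of the limiting rate. -/
def limitIntegrand (S : MultiTier T) (t : Fin T) (z : ℝ) : ℝ :=
  (1 - mgfNeg (S.serving t) z) / S.Ztilde t z * (1 / z)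

/-- The common closed form of the dense-network and interference-limited rates. -/
def limitRate (S : MultiTier T) (t : Fin T) : ℝ := ∫ z in Ioi (0 : ℝ), S.limitIntegrand t z

/-- Integrand of the high-SNR correction. -/
def correctionIntegrand (S : MultiTier T) (t : Fin T) (z : ℝ) : ℝ :=
  (1 - mgfNeg (S.serving t) z) / (S.Ztilde t z) ^ (1 + S.α / 2)

/-- The high-SNR expression, with `SNR_t = χ t * snr`. -/
def highSNRRate (S : MultiTier T) (lam snr : ℝ) (t : Fin T) : ℝ :=
  S.limitRate t - (Real.pi * (S.κ t * lam / S.F t)) ^ (-(S.α / 2)) * Real.Gamma (1 + S.α / 2) *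
    (1 / (S.χ t * snr)) * ∫ z in Ioi (0 : ℝ), S.correctionIntegrand t z

end MultiTier

end

/-! The average rate has the form `∫ h exp (-s x)` over the quadrant of pairs `(z, u)`. Here `h = (1
- M_{t,0}(z)) / z * exp (-Z_t(z) u)` and `x = z u^(α/2)` do not involve density, power scale or
noise, which enter only through `s = σ² / P_t * (π λ_t / F_t)^(-α/2)`. Vanishing noise and growing
density both mean `s → 0`, hence the common limit `∫ h`; integrating out `u` turns it into
`limitRate`. The upper bound is `exp (-s x) ≤ 1` and the lower bound is `exp (-s x) ≥ 1 - s x`,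
where `∫ h x` is the correction integral times `Γ(1 + α/2)`. Dominated convergence makes the error
of the second bound `o(s)`, and `s` is proportional to `1 / SNR`.

To reach this form, `ofReal_log_one_add_div` writes `log (1 + g / n)` as `∫ (1 - exp (-z g)) / z *
exp (-z n) dz`, which separates the serving gain from noise plus interference. By independence only
`M_{t,0}` and the Laplace transform of the interference remain. The latter follows from the Laplace
functional of a Poisson process (`IsPoissonProcess.lintegral_expNeg`), itself deduced from the joint
law of counts, after integrating out the marks (`lintegral_expNeg_marked`). A layer-cake argument in
the plane (`lintegral_plane_eq_excess`) produces the exponent `M_q + T_q - 1`. Together with the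
association exponent it adds up to `π λ_t / F_t * Z_t(z) ξ²`, and the substitution `u = π λ_t / F_t
* ξ²` concludes.

Convergence rests on `Z_t ≥ 1` and on the growth `Z_t(z) ≥ c z^(2/α)`. Interference may a priori be
infinite, so exponentials are taken on `[0, ∞]`, where Tonelli's theorem needs no integrability. -/

noncomputable section

/-! ### Exponential and logarithm on `[0, ∞]` -/

/-- The function `x ↦ exp (-x)` on `[0, ∞]`. -/
def expNeg (x : ℝ≥0∞) : ℝ≥0∞ := EReal.exp (-(x : EReal))

@[simp] lemma expNeg_zero : expNeg 0 = 1 := by simp [expNeg]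

@[simp] lemma expNeg_top : expNeg ∞ = 0 := by simp [expNeg]

lemma expNeg_add (x y : ℝ≥0∞) : expNeg (x + y) = expNeg x * expNeg y := by
  unfold expNeg
  rw [EReal.coe_ennreal_add, EReal.neg_add, sub_eq_add_neg, EReal.exp_add]
  · exact Or.inl (by simp)
  · exact Or.inr (by simp)

lemma expNeg_sum {ι : Type*} (s : Finset ι) (f : ι → ℝ≥0∞) :
    expNeg (∑ i ∈ s, f i) = ∏ i ∈ s, expNeg (f i) := by
  classical
  induction s using Finset.induction_on with
  | empty => simp
  | insert a s ha ih => rw [Finset.sum_insert ha, Finset.prod_insert ha, expNeg_add, ih]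

lemma continuous_expNeg : Continuous expNeg :=
  ENNReal.continuous_exp.comp (continuous_neg.comp continuous_coe_ennreal_ereal)

lemma measurable_expNeg : Measurable expNeg := continuous_expNeg.measurable

lemma antitone_expNeg : Antitone expNeg := fun x y h => by
  unfold expNeg
  rw [EReal.exp_le_exp_iff, EReal.neg_le_neg_iff]
  exact_mod_cast h

lemma expNeg_le_one (x : ℝ≥0∞) : expNeg x ≤ 1 := by
  simpa using antitone_expNeg (zero_le : 0 ≤ x)

lemma expNeg_ne_top (x : ℝ≥0∞) : expNeg x ≠ ∞ := ne_top_of_le_ne_top (by simp) (expNeg_le_one x)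

lemma expNeg_ofReal {x : ℝ} (hx : 0 ≤ x) : expNeg (ENNReal.ofReal x) = ENNReal.ofReal (Real.exp (-x)) := by
  unfold expNeg
  rw [EReal.coe_ennreal_ofReal, max_eq_left hx, ← EReal.coe_neg, EReal.exp_coe]

lemma one_sub_expNeg_ofReal {x : ℝ} (hx : 0 ≤ x) :
    1 - expNeg (ENNReal.ofReal x) = ENNReal.ofReal (1 - Real.exp (-x)) := by
  rw [expNeg_ofReal hx, ENNReal.ofReal_sub _ (Real.exp_nonneg _), ENNReal.ofReal_one]

/-- The inverse of `expNeg` on `[0, 1]`. -/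
def negLog (y : ℝ≥0∞) : ℝ≥0∞ := (-ENNReal.log y).toENNReal

lemma measurable_negLog : Measurable negLog :=
  EReal.continuous_toENNReal.measurable.comp (continuous_neg.measurable.comp ENNReal.measurable_log)

/-- This turns a product of factors in `[0, 1]` into `expNeg` of a sum, so that the Laplace
functional applies to it; the factor `0` corresponds to the exponent `∞`. -/
lemma expNeg_negLog {y : ℝ≥0∞} (hy : y ≤ 1) : expNeg (negLog y) = y := by
  unfold expNeg negLog
  rw [EReal.coe_toENNReal, neg_neg, ENNReal.exp_log]
  rw [EReal.neg_nonneg]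
  simpa using ENNReal.log_le_log_iff.2 hy

lemma tendsto_expNeg_sum_tsum (f : ℕ → ℝ≥0∞) :
    Tendsto (fun N => ∏ n ∈ Finset.range N, expNeg (f n)) atTop (𝓝 (expNeg (∑' n, f n))) := by
  simp_rw [← expNeg_sum]
  exact (continuous_expNeg.tendsto _).comp ENNReal.summable.hasSum.tendsto_sum_nat

lemma one_sub_expNeg_mono {x y : ℝ≥0∞} (h : x ≤ y) : 1 - expNeg x ≤ 1 - expNeg y :=
  tsub_le_tsub_left (antitone_expNeg h) 1

/-! ### Laplace functional of a Poisson process -/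

/-- The number of points of the configuration `x` in `A`. -/
def pointCount (x : ℕ → Plane) (A : Set Plane) : ℝ≥0∞ := ∑' n, A.indicator 1 (x n)

lemma pointCount_eq_natCast_iff (x : ℕ → Plane) (A : Set Plane) (k : ℕ) :
    pointCount x A = k ↔ {n : ℕ | x n ∈ A}.encard = (k : ℕ∞) := by
  have : pointCount x A = ({n : ℕ | x n ∈ A}.encard : ℝ≥0∞) := by
    rw [← ENNReal.tsum_set_one, tsum_subtype {n : ℕ | x n ∈ A} (fun _ => (1 : ℝ≥0∞))]
    rfl
  rw [this]
  norm_cast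

lemma measurable_pointCount {Ω : Type*} [MeasurableSpace Ω] {X : ℕ → Ω → Plane}
    (hX : ∀ n, Measurable (X n)) {A : Set Plane} (hA : MeasurableSet A) :
    Measurable fun ω => pointCount (fun n => X n ω) A :=
  Measurable.tsum fun n => (measurable_one.indicator hA).comp (hX n)

/-- If the points of `X` form a Poisson process of intensity `r`, the counts of points in disjoint
sets of finite area are jointly distributed as independent Poisson variables. -/
lemma IsPoissonProcess.map_pointCount {Ω : Type*} [MeasurableSpace Ω] {P : Measure Ω}
    [IsProbabilityMeasure P] {X : ℕ → Ω → Plane} {r : ℝ} (h : IsPoissonProcess P X r)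
    {m : ℕ} (A : Fin m → Set Plane) (hA : ∀ i, MeasurableSet (A i)) (hfin : ∀ i, volume (A i) < ∞)
    (hd : Pairwise fun i j => Disjoint (A i) (A j)) :
    (Measure.pi fun i => poissonMeasure (Real.toNNReal (r * (volume (A i)).toReal))).map
      (fun k i => (k i : ℝ≥0∞)) = P.map (fun ω i => pointCount (fun n => X n ω) (A i)) := by
  set μ := Measure.pi fun i => poissonMeasure (Real.toNNReal (r * (volume (A i)).toReal))
  have hN : Measurable fun ω i => pointCount (fun n => X n ω) (A i) :=
    measurable_pi_lambda _ fun i => measurable_pointCount h.1 (hA i)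
  have hc : Measurable fun (k : Fin m → ℕ) i => (k i : ℝ≥0∞) := .of_discrete
  have : IsProbabilityMeasure (μ.map (fun k i => (k i : ℝ≥0∞))) :=
    Measure.isProbabilityMeasure_map hc.aemeasurable
  have : IsProbabilityMeasure (P.map (fun ω i => pointCount (fun n => X n ω) (A i))) :=
    Measure.isProbabilityMeasure_map hN.aemeasurable
  -- The hypothesis only gives the probabilities of finite counts, so a priori some mass could sit
  -- at infinite counts. One inequality suffices, since both laws have mass one.
  refine Measure.eq_of_le_of_measure_univ_eq (Measure.le_intro fun S hS _ => ?_) (by simp)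
  rw [Measure.map_apply hc hS, Measure.map_apply hN hS]
  set B := (fun (k : Fin m → ℕ) i => (k i : ℝ≥0∞)) ⁻¹' S
  have hpt : ∀ k : Fin m → ℕ,
      {ω | ∀ i, {n : ℕ | X n ω ∈ A i}.encard = (k i : ℕ∞)} =
        (fun ω i => pointCount (fun n => X n ω) (A i)) ⁻¹' {fun i => (k i : ℝ≥0∞)} := by
    intro k
    ext ω
    simp only [mem_ofPred_eq, mem_preimage, mem_singleton_iff, funext_iff,
      pointCount_eq_natCast_iff]
  have h1 : μ B = ∑' k : B, μ {(k : Fin m → ℕ)} := by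
    rw [← measure_biUnion (to_countable B) (fun i _ j _ hij => by simpa using hij) (by simp),
      biUnion_of_singleton]
  have h2 : ∀ k : Fin m → ℕ,
      μ {k} = P ((fun ω i => pointCount (fun n => X n ω) (A i)) ⁻¹' {fun i => (k i : ℝ≥0∞)}) := by
    intro k
    rw [← hpt, h.2 m A k hA hfin hd, ← univ_pi_singleton, Measure.pi_pi]
  rw [h1]
  simp_rw [h2]
  rw [← measure_biUnion (f := fun k : Fin m → ℕ =>
    (fun ω i => pointCount (fun n => X n ω) (A i)) ⁻¹' {fun i => (k i : ℝ≥0∞)}) (to_countable B)]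
  · refine measure_mono (iUnion₂_subset fun k hk ω hω => ?_)
    simp only [mem_preimage, mem_singleton_iff] at hω ⊢
    rw [hω]
    exact hk
  · intro i _ j _ hij
    refine Disjoint.preimage _ ?_
    simp only [disjoint_singleton, ne_eq, funext_iff, Nat.cast_inj]
    simpa [funext_iff] using hij
  · exact fun k _ => hN (measurableSet_singleton _)

/-- Generating function of the Poisson law at `e = expNeg a`. The case `a = ∞` is covered because `∞
* 0 = 0` on the left matches `0 ^ 0 = 1` in the series. -/
lemma lintegral_expNeg_mul_poissonMeasure (r : ℝ≥0) (a : ℝ≥0∞) :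
    ∫⁻ k, expNeg (a * (k : ℝ≥0∞)) ∂(poissonMeasure r) = expNeg (r * (1 - expNeg a)) := by
  obtain ⟨e, he⟩ : ∃ e : ℝ≥0, expNeg a = e := ⟨_, (ENNReal.coe_toNNReal (expNeg_ne_top a)).symm⟩
  have hk : ∀ k : ℕ, expNeg (a * (k : ℝ≥0∞)) = ENNReal.ofReal ((e : ℝ) ^ k) := by
    intro k
    have := expNeg_sum (Finset.range k) (fun _ => a)
    simp only [Finset.sum_const, Finset.prod_const, Finset.card_range, nsmul_eq_mul] at this
    rw [mul_comm, this, he, ENNReal.ofReal_pow e.coe_nonneg, ENNReal.ofReal_coe_nnreal]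
  have h1 : (e : ℝ) ≤ 1 := by
    have := expNeg_le_one a
    rw [he] at this
    exact_mod_cast this
  simp_rw [hk]
  have hm : (r : ℝ≥0∞) * (1 - expNeg a) = ENNReal.ofReal (r * (1 - e)) := by
    rw [he, ENNReal.ofReal_mul r.coe_nonneg, ENNReal.ofReal_sub _ e.coe_nonneg, ENNReal.ofReal_coe_nnreal,
      ENNReal.ofReal_coe_nnreal, ENNReal.ofReal_one]
  rw [hm, expNeg_ofReal (mul_nonneg r.coe_nonneg (by linarith)), poissonMeasure, lintegral_sum_measure]
  simp only [lintegral_smul_measure, lintegral_dirac, smul_eq_mul]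
  have hs : HasSum (fun n : ℕ => Real.exp (-r) * (r : ℝ) ^ n / n.factorial * (e : ℝ) ^ n)
      (Real.exp (-(r * (1 - e)))) := by
    have := (NormedSpace.expSeries_div_hasSum_exp ((r : ℝ) * e)).mul_left (Real.exp (-r))
    rw [← Real.exp_eq_exp_ℝ, ← Real.exp_add] at this
    rw [show -((r : ℝ) * (1 - e)) = -r + r * e by ring]
    have he : (fun n : ℕ => Real.exp (-r) * (r : ℝ) ^ n / n.factorial * (e : ℝ) ^ n) =
        fun n : ℕ => Real.exp (-r) * (((r : ℝ) * e) ^ n / n.factorial) := by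
      ext n
      rw [mul_pow]
      ring
    rw [he]
    exact this
  simp_rw [← ENNReal.ofReal_mul (show (0 : ℝ) ≤ Real.exp (-r) * (r : ℝ) ^ _ / (Nat.factorial _ : ℝ) by positivity)]
  rw [← ENNReal.ofReal_tsum_of_nonneg (fun n => by positivity) hs.summable, hs.tsum_eq]

/-- On the product of Poisson laws the exponential of the sum factorizes, and each factor is a
generating function. -/
lemma IsPoissonProcess.lintegral_expNeg_pointCount {Ω : Type*} [MeasurableSpace Ω] {P : Measure Ω}
    [IsProbabilityMeasure P] {X : ℕ → Ω → Plane} {r : ℝ} (h : IsPoissonProcess P X r)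
    {m : ℕ} (A : Fin m → Set Plane) (hA : ∀ i, MeasurableSet (A i)) (hfin : ∀ i, volume (A i) < ∞)
    (hd : Pairwise fun i j => Disjoint (A i) (A j)) (a : Fin m → ℝ≥0∞) :
    ∫⁻ ω, expNeg (∑ i, a i * pointCount (fun n => X n ω) (A i)) ∂P =
      expNeg (∑ i, ENNReal.ofReal r * volume (A i) * (1 - expNeg (a i))) := by
  have hN : Measurable fun ω i => pointCount (fun n => X n ω) (A i) :=
    measurable_pi_lambda _ fun i => measurable_pointCount h.1 (hA i)
  have hc : Measurable fun (k : Fin m → ℕ) i => (k i : ℝ≥0∞) := .of_discrete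
  have hf : Measurable fun v : Fin m → ℝ≥0∞ => expNeg (∑ i, a i * v i) :=
    measurable_expNeg.comp (by fun_prop)
  rw [← lintegral_map (f := fun v : Fin m → ℝ≥0∞ => expNeg (∑ i, a i * v i)) hf hN,
    ← h.map_pointCount A hA hfin hd, lintegral_map hf hc]
  simp_rw [expNeg_sum]
  set μ := fun i => poissonMeasure (Real.toNNReal (r * (volume (A i)).toReal))
  rw [lintegral_prod_eq_prod_lintegral_of_indepFun (μ := Measure.pi μ) Finset.univ
    (fun i (k : Fin m → ℕ) => expNeg (a i * (k i : ℝ≥0∞)))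
    (iIndepFun_pi (X := fun i (k : ℕ) => expNeg (a i * (k : ℝ≥0∞)))
      (fun i => Measurable.of_discrete.aemeasurable)) (fun i => .of_discrete)]
  refine Finset.prod_congr rfl fun i _ => ?_
  rw [(measurePreserving_eval μ i).lintegral_comp (f := fun k : ℕ => expNeg (a i * (k : ℝ≥0∞)))
    .of_discrete, lintegral_expNeg_mul_poissonMeasure]
  congr 2
  rw [← ENNReal.ofReal_toReal (hfin i).ne, ← ENNReal.ofReal_mul' ENNReal.toReal_nonneg,
    ENNReal.toReal_ofReal ENNReal.toReal_nonneg]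
  rfl

/-- Laplace functional of a Poisson process, for simple functions supported on a set of finite
area. -/
lemma IsPoissonProcess.lintegral_expNeg_simpleFunc {Ω : Type*} [MeasurableSpace Ω] {P : Measure Ω}
    [IsProbabilityMeasure P] {X : ℕ → Ω → Plane} {r : ℝ} (h : IsPoissonProcess P X r)
    (f : SimpleFunc Plane ℝ≥0∞) (hf : volume {x | f x ≠ 0} < ∞) :
    ∫⁻ ω, expNeg (∑' n, f (X n ω)) ∂P =
      expNeg (ENNReal.ofReal r * ∫⁻ x, (1 - expNeg (f x))) := by
  classical
  -- The value `0` is left out: its level set has infinite area, and it contributes nothing to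
  -- either side.
  set s : Finset ℝ≥0∞ := f.range.filter (· ≠ 0)
  set e : Fin s.card ≃ s := s.equivFin.symm
  -- Needed twice: for `g = id` in the sum over points and for `g y = 1 - expNeg y` in the area
  -- integral.
  have hf_eq : ∀ (g : ℝ≥0∞ → ℝ≥0∞), g 0 = 0 → ∀ x,
      g (f x) = ∑ i : Fin s.card, g (e i) * (f ⁻¹' {(e i : ℝ≥0∞)}).indicator 1 x := by
    intro g hg x
    rw [Equiv.sum_comp e (fun y : s => g y * (f ⁻¹' {(y : ℝ≥0∞)}).indicator 1 x),
      Finset.sum_coe_sort s (fun y => g y * (f ⁻¹' {y}).indicator 1 x)]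
    by_cases hx : f x = 0
    · rw [hx, hg, Finset.sum_eq_zero]
      intro y hy
      have : y ≠ 0 := (Finset.mem_filter.1 hy).2
      rw [indicator_of_notMem, mul_zero]
      simpa [hx] using this.symm
    · rw [Finset.sum_eq_single (f x)]
      · simp
      · intro y _ hy
        rw [indicator_of_notMem, mul_zero]
        simpa using hy.symm
      · intro hn
        exact absurd (Finset.mem_filter.2 ⟨f.mem_range_self x, hx⟩) hn
  have hA : ∀ i, MeasurableSet (f ⁻¹' {(e i : ℝ≥0∞)}) := fun i => f.measurableSet_fiber _
  have key := h.lintegral_expNeg_pointCount (fun i => f ⁻¹' {(e i : ℝ≥0∞)}) hA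
    (fun i => (measure_mono fun x hx => by
      have : (e i : ℝ≥0∞) ≠ 0 := (Finset.mem_filter.1 (e i).2).2
      simp only [mem_preimage, mem_singleton_iff] at hx
      simpa [hx] using this).trans_lt hf)
    (fun i j hij => Disjoint.preimage _ (by
      simpa [Subtype.ext_iff] using e.injective.ne hij)) (fun i => (e i : ℝ≥0∞))
  convert key using 1
  · refine lintegral_congr fun ω => ?_
    congr 1
    simp_rw [pointCount, ← ENNReal.tsum_mul_left]
    rw [← Summable.tsum_finsetSum (fun i _ => ENNReal.summable)]
    exact tsum_congr fun n => hf_eq id rfl _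
  · congr 1
    simp_rw [hf_eq (fun y => 1 - expNeg y) (by simp)]
    rw [lintegral_finsetSum _ fun i _ => (measurable_one.indicator (hA i)).const_mul _,
      Finset.mul_sum]
    refine Finset.sum_congr rfl fun i _ => ?_
    rw [lintegral_const_mul _ (measurable_one.indicator (hA i)), lintegral_indicator_one (hA i)]
    ring

/-- Laplace functional of a Poisson process. -/
theorem IsPoissonProcess.lintegral_expNeg {Ω : Type*} [MeasurableSpace Ω] {P : Measure Ω}
    [IsProbabilityMeasure P] {X : ℕ → Ω → Plane} {r : ℝ} (h : IsPoissonProcess P X r)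
    {f : Plane → ℝ≥0∞} (hf : Measurable f) :
    ∫⁻ ω, expNeg (∑' n, f (X n ω)) ∂P =
      expNeg (ENNReal.ofReal r * ∫⁻ x, (1 - expNeg (f x))) := by
  -- Cutting off to growing balls makes the supports of finite area and keeps the approximation
  -- monotone.
  set φ : ℕ → SimpleFunc Plane ℝ≥0∞ := fun k =>
    (SimpleFunc.eapprox f k).restrict (Metric.ball 0 k)
  have hφ : ∀ k x, φ k x = (Metric.ball (0 : Plane) k).indicator (SimpleFunc.eapprox f k) x :=
    fun k x => SimpleFunc.restrict_apply _ measurableSet_ball _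
  have hmono : ∀ x, Monotone fun k => φ k x := by
    intro x k l hkl
    simp only [hφ]
    refine (indicator_le_indicator_of_subset (Metric.ball_subset_ball (Nat.cast_le.2 hkl))
      (fun _ => zero_le) x).trans ?_
    exact indicator_le_indicator (SimpleFunc.monotone_eapprox f hkl x)
  have hlim : ∀ x, Tendsto (fun k => φ k x) atTop (𝓝 (f x)) := by
    intro x
    refine (SimpleFunc.tendsto_eapprox hf x).congr' ?_
    obtain ⟨k₀, hk₀⟩ := exists_nat_gt ‖x‖
    filter_upwards [eventually_ge_atTop k₀] with k hk
    rw [hφ, indicator_of_mem]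
    simpa using hk₀.trans_le (by exact_mod_cast hk)
  have hsupp : ∀ k, volume {x | φ k x ≠ 0} < ∞ := fun k => by
    refine (measure_mono (t := Metric.ball 0 k) fun x hx => ?_).trans_lt measure_ball_lt_top
    by_contra hn
    exact hx (by rw [hφ, indicator_of_notMem hn])
  have hsum : ∀ ω, Tendsto (fun k => ∑' n, φ k (X n ω)) atTop (𝓝 (∑' n, f (X n ω))) := by
    intro ω
    simp_rw [← lintegral_count]
    exact lintegral_tendsto_of_tendsto_of_monotone (fun k => Measurable.of_discrete.aemeasurable)
      (.of_forall fun n => hmono _) (.of_forall fun n => hlim _)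
  have hX := h.1
  have h1 : Tendsto (fun k => ∫⁻ ω, expNeg (∑' n, φ k (X n ω)) ∂P) atTop
      (𝓝 (∫⁻ ω, expNeg (∑' n, f (X n ω)) ∂P)) := by
    refine tendsto_lintegral_of_dominated_convergence (fun _ => 1)
      (fun k => measurable_expNeg.comp (Measurable.tsum fun n =>
        (φ k).measurable.comp (hX n))) (fun k => .of_forall fun ω => expNeg_le_one _) (by simp)
      (.of_forall fun ω => (continuous_expNeg.tendsto _).comp (hsum ω))
  have h2 : Tendsto (fun k => ∫⁻ x, (1 - expNeg (φ k x))) atTop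
      (𝓝 (∫⁻ x, (1 - expNeg (f x)))) := by
    refine lintegral_tendsto_of_tendsto_of_monotone
      (fun k => (measurable_const.sub (measurable_expNeg.comp (φ k).measurable)).aemeasurable)
      (.of_forall fun x k l hkl => one_sub_expNeg_mono (hmono x hkl)) (.of_forall fun x => ?_)
    exact ENNReal.Tendsto.sub tendsto_const_nhds ((continuous_expNeg.tendsto _).comp (hlim x))
      (Or.inl (by simp))
  refine tendsto_nhds_unique h1 ?_
  simp_rw [fun k => h.lintegral_expNeg_simpleFunc (φ k) (hsupp k)]
  exact (continuous_expNeg.tendsto _).comp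
    (ENNReal.Tendsto.const_mul h2 (Or.inr ENNReal.ofReal_ne_top))

/-! ### Independent marks and shot noise -/

/-- Integrating out independent marks of a sequence of random points. -/
lemma lintegral_expNeg_marked {Ω E M : Type*} [MeasurableSpace Ω] [MeasurableSpace E]
    [MeasurableSpace M] {P : Measure Ω} [IsProbabilityMeasure P] {X : ℕ → Ω → E} {m : ℕ → Ω → M}
    (hX : ∀ n, Measurable (X n)) (hm : ∀ n, Measurable (m n))
    (hXm : IndepFun (fun ω n => X n ω) (fun ω n => m n ω) P) (hmi : iIndepFun m P)
    {f : E → M → ℝ≥0∞} (hf : Measurable (Function.uncurry f)) {φ : E → ℝ≥0∞}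
    (hφ : ∀ n x, ∫⁻ ω, expNeg (f x (m n ω)) ∂P = φ x) :
    ∫⁻ ω, expNeg (∑' n, f (X n ω) (m n ω)) ∂P =
      ∫⁻ ω, expNeg (∑' n, negLog (φ (X n ω))) ∂P := by
  have hX' : Measurable fun ω n => X n ω := measurable_pi_lambda _ hX
  have hm' : Measurable fun ω n => m n ω := measurable_pi_lambda _ hm
  have hle : ∀ x, φ x ≤ 1 := fun x => by
    rw [← hφ 0 x]
    calc _ ≤ ∫⁻ _, 1 ∂P := lintegral_mono fun ω => expNeg_le_one _
      _ = 1 := by simp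
  have hF : Measurable fun z : (ℕ → E) × (ℕ → M) => expNeg (∑' n, f (z.1 n) (z.2 n)) := by
    refine measurable_expNeg.comp (Measurable.tsum fun n => ?_)
    exact hf.comp (g := Function.uncurry f) (f := fun z : (ℕ → E) × (ℕ → M) => (z.1 n, z.2 n))
      (((measurable_pi_apply n).comp measurable_fst).prodMk
        ((measurable_pi_apply n).comp measurable_snd))
  have hφm : Measurable φ := by
    have : φ = fun x => ∫⁻ ω, expNeg (f x (m 0 ω)) ∂P := funext fun x => (hφ 0 x).symm
    rw [this]
    refine Measurable.lintegral_prod_right' (f := fun z : E × Ω => expNeg (f z.1 (m 0 z.2))) ?_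
    exact measurable_expNeg.comp (hf.comp (measurable_fst.prodMk ((hm 0).comp measurable_snd)))
  have hG : Measurable fun x : ℕ → E => expNeg (∑' n, negLog (φ (x n))) :=
    measurable_expNeg.comp (Measurable.tsum fun n =>
      measurable_negLog.comp (hφm.comp (measurable_pi_apply n)))
  have key := (indepFun_iff_map_prod_eq_prod_map_map hX'.aemeasurable hm'.aemeasurable).1 hXm
  rw [← lintegral_map (f := fun z : (ℕ → E) × (ℕ → M) => expNeg (∑' n, f (z.1 n) (z.2 n))) hF
    (hX'.prodMk hm'), key]
  have : IsProbabilityMeasure (P.map fun ω n => m n ω) :=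
    Measure.isProbabilityMeasure_map hm'.aemeasurable
  rw [lintegral_prod _ hF.aemeasurable,
    ← lintegral_map (f := fun x : ℕ → E => expNeg (∑' n, negLog (φ (x n)))) hG hX']
  refine lintegral_congr fun x => ?_
  rw [lintegral_map (f := fun y : ℕ → M => expNeg (∑' n, f (x n) (y n)))
    (hF.comp measurable_prodMk_left) hm']
  have hmeas : ∀ n, Measurable fun ω => expNeg (f (x n) (m n ω)) := fun n =>
    measurable_expNeg.comp ((hf.comp measurable_prodMk_left).comp (hm n))
  -- With the positions `x` frozen, independence of the marks factorizes every finite product; both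
  -- sides are limits of these products.
  have h1 : ∀ N, ∫⁻ ω, ∏ n ∈ Finset.range N, expNeg (f (x n) (m n ω)) ∂P =
      ∏ n ∈ Finset.range N, expNeg (negLog (φ (x n))) := fun N => by
    rw [lintegral_prod_eq_prod_lintegral_of_indepFun _
      (fun n ω => expNeg (f (x n) (m n ω))) (hmi.comp (fun n y => expNeg (f (x n) y))
        fun n => measurable_expNeg.comp (hf.comp measurable_prodMk_left)) hmeas]
    exact Finset.prod_congr rfl fun n _ => by rw [hφ, expNeg_negLog (hle _)]
  refine tendsto_nhds_unique (f := fun N => ∫⁻ ω, ∏ n ∈ Finset.range N, expNeg (f (x n) (m n ω)) ∂P)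
    (l := atTop) ?_ ?_
  · refine tendsto_lintegral_of_dominated_convergence (fun _ => 1)
      (fun N => Finset.measurable_prod _ fun n _ => hmeas n)
      (fun N => .of_forall fun ω => Finset.prod_le_one' fun n _ => expNeg_le_one _) (by simp)
      (.of_forall fun ω => tendsto_expNeg_sum_tsum _)
  · simp_rw [h1]
    exact tendsto_expNeg_sum_tsum _

/-- Laplace transform of the shot noise created by the points of a marked Poisson process that lie
at distance more than `R` and have picked one of `F` bands. -/
lemma IsPoissonProcess.lintegral_expNeg_shotNoise {Ω : Type*} [MeasurableSpace Ω] {P : Measure Ω}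
    [IsProbabilityMeasure P] {X : ℕ → Ω → Plane} {r : ℝ} (h : IsPoissonProcess P X r)
    {F : ℕ} (hF : 1 ≤ F) {G : ℕ → Ω → ℝ} {b : ℕ → Ω → Fin F} {ν : Measure ℝ}
    (hG : ∀ n, Measurable (G n)) (hGν : ∀ n, P.map (G n) = ν) (hb : ∀ n, Measurable (b n))
    (hbu : ∀ n j, P {ω | b n ω = j} = (F : ℝ≥0∞)⁻¹) (hGb : ∀ n, IndepFun (G n) (b n) P)
    (hi : iIndepFun (fun n ω => (G n ω, b n ω)) P)
    (hX : IndepFun (fun ω n => X n ω) (fun ω n => (G n ω, b n ω)) P) (a α R : ℝ) (s : ℝ≥0∞) :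
    open Classical in
    ∫⁻ ω, expNeg (s * ∑' n, if R < ‖X n ω‖ ∧ (b n ω : ℕ) = 0 then
      ENNReal.ofReal (a * G n ω * ‖X n ω‖ ^ (-α)) else 0) ∂P =
    expNeg (ENNReal.ofReal r * ((F : ℝ≥0∞)⁻¹ * ∫⁻ x in {x : Plane | R < ‖x‖},
      ∫⁻ g, (1 - expNeg (s * ENNReal.ofReal (a * g * ‖x‖ ^ (-α)))) ∂ν)) := by
  classical
  set f : Plane → ℝ × Fin F → ℝ≥0∞ := fun x y =>
    if R < ‖x‖ ∧ (y.2 : ℕ) = 0 then s * ENNReal.ofReal (a * y.1 * ‖x‖ ^ (-α)) else 0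
  have hAmeas : MeasurableSet {x : Plane | R < ‖x‖} := measurableSet_lt measurable_const measurable_norm
  have hf : Measurable (Function.uncurry f) := by
    refine Measurable.ite ?_ (by fun_prop) measurable_const
    refine MeasurableSet.inter (s₁ := {z : Plane × ℝ × Fin F | R < ‖z.1‖})
      (s₂ := {z : Plane × ℝ × Fin F | (z.2.2 : ℕ) = 0}) (hAmeas.preimage measurable_fst) ?_
    exact MeasurableSet.preimage (t := {j : Fin F | (j : ℕ) = 0}) .of_discrete
      measurable_snd.snd
  have hν : IsProbabilityMeasure ν := hGν 0 ▸ Measure.isProbabilityMeasure_map (hG 0).aemeasurable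
  -- `ψ x` is the mean of `1 - expNeg (f x mark)`, which is what the Laplace functional integrates
  -- over the plane.
  set ψ : Plane → ℝ≥0∞ := fun x => (F : ℝ≥0∞)⁻¹ * {x : Plane | R < ‖x‖}.indicator
    (fun x => ∫⁻ g, (1 - expNeg (s * ENNReal.ofReal (a * g * ‖x‖ ^ (-α)))) ∂ν) x
  have hint : ∀ x : Plane, Measurable fun g : ℝ => 1 - expNeg (s * ENNReal.ofReal (a * g * ‖x‖ ^ (-α))) :=
    fun x => measurable_const.sub (measurable_expNeg.comp (by fun_prop))
  have hmark : ∀ n, Measurable fun ω => (G n ω, b n ω) := fun n => (hG n).prodMk (hb n)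
  have hfm : ∀ n x, Measurable fun ω => expNeg (f x (G n ω, b n ω)) := fun n x =>
    measurable_expNeg.comp ((hf.comp measurable_prodMk_left).comp (hmark n))
  have hψ : ∀ n x, ∫⁻ ω, (1 - expNeg (f x (G n ω, b n ω))) ∂P = ψ x := by
    intro n x
    by_cases hx : R < ‖x‖
    · have h1 : ∀ ω, 1 - expNeg (f x (G n ω, b n ω)) =
          (1 - expNeg (s * ENNReal.ofReal (a * G n ω * ‖x‖ ^ (-α)))) *
            {j : Fin F | (j : ℕ) = 0}.indicator 1 (b n ω) := by
        intro ω
        by_cases hω : (b n ω : ℕ) = 0 <;> simp [f, hx, hω]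
      simp_rw [h1]
      rw [lintegral_mul_eq_lintegral_mul_lintegral_of_indepFun''
        (f := fun ω => 1 - expNeg (s * ENNReal.ofReal (a * G n ω * ‖x‖ ^ (-α))))
        (g := fun ω => {j : Fin F | (j : ℕ) = 0}.indicator 1 (b n ω))
        ((hint x).comp (hG n)).aemeasurable
        ((measurable_one.indicator .of_discrete).comp (hb n)).aemeasurable
        ((hGb n).comp (hint x) (measurable_one.indicator .of_discrete))]
      have h2 : ∫⁻ ω, {j : Fin F | (j : ℕ) = 0}.indicator (1 : Fin F → ℝ≥0∞) (b n ω) ∂P =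
          (F : ℝ≥0∞)⁻¹ := by
        have h3 : MeasurableSet {ω | b n ω = ⟨0, hF⟩} := (hb n) (measurableSet_singleton _)
        rw [← hbu n ⟨0, hF⟩, ← lintegral_indicator_one h3]
        refine lintegral_congr fun ω => ?_
        simp [indicator, Fin.ext_iff]
      simp only [ψ]
      rw [h2, indicator_of_mem (show x ∈ {x : Plane | R < ‖x‖} from hx), mul_comm, ← hGν n,
        lintegral_map (hint x) (hG n)]
    · simp [f, ψ, hx]
  have hψ1 : ∀ x, ψ x ≤ 1 := fun x => by
    rw [← hψ 0 x]
    calc _ ≤ ∫⁻ _, 1 ∂P := lintegral_mono fun ω => tsub_le_self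
      _ = 1 := by simp
  have hφ : ∀ n x, ∫⁻ ω, expNeg (f x (G n ω, b n ω)) ∂P = 1 - ψ x := by
    intro n x
    rw [← hψ n x, lintegral_sub (hfm n x) _ (.of_forall fun ω => expNeg_le_one _)]
    · simp only [lintegral_const, measure_univ, mul_one]
      refine (ENNReal.sub_sub_cancel (by simp) ?_).symm
      calc _ ≤ ∫⁻ _, 1 ∂P := lintegral_mono fun ω => expNeg_le_one _
        _ = 1 := by simp
    · refine ne_top_of_le_ne_top (b := 1) (by simp) ?_
      calc _ ≤ ∫⁻ _, 1 ∂P := lintegral_mono fun ω => expNeg_le_one _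
        _ = 1 := by simp
  have hψm : Measurable ψ := by
    refine Measurable.const_mul (Measurable.indicator ?_ hAmeas) _
    refine Measurable.lintegral_prod_right' (f := fun z : Plane × ℝ =>
      1 - expNeg (s * ENNReal.ofReal (a * z.2 * ‖z.1‖ ^ (-α)))) ?_
    exact measurable_const.sub (measurable_expNeg.comp (by fun_prop))
  have key := lintegral_expNeg_marked h.1 hmark hX hi hf hφ
  have hcongr : ∀ ω, (s * ∑' n, if R < ‖X n ω‖ ∧ (b n ω : ℕ) = 0 then
      ENNReal.ofReal (a * G n ω * ‖X n ω‖ ^ (-α)) else 0) = ∑' n, f (X n ω) (G n ω, b n ω) := by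
    intro ω
    rw [← ENNReal.tsum_mul_left]
    refine tsum_congr fun n => ?_
    simp only [f]
    split_ifs <;> simp
  simp_rw [hcongr]
  rw [key, h.lintegral_expNeg (f := fun x => negLog (1 - ψ x))
    (measurable_negLog.comp (measurable_const.sub hψm))]
  congr 2
  simp_rw [fun x => expNeg_negLog (tsub_le_self : 1 - ψ x ≤ 1),
    fun x => ENNReal.sub_sub_cancel ENNReal.one_ne_top (hψ1 x)]
  rw [lintegral_const_mul' _ _ (ENNReal.inv_ne_top.2 (by exact_mod_cast (by omega : F ≠ 0))),
    lintegral_indicator hAmeas]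

/-! ### Interference of independent tiers -/

namespace MultiTier

variable {T : ℕ}

/-- The interference created by tier `q`, as a function of the configuration of its BSs. -/
def tierInterference (S : MultiTier T) (p : ℝ) (t : Fin T) (ξ : ℝ) (q : Fin T)
    (c : ℕ → Plane × ℝ × Fin (S.F q)) : ℝ≥0∞ :=
  open Classical in
  ∑' n, if S.exclusionRadius t q ξ < ‖(c n).1‖ ∧ ((c n).2.2 : ℕ) = 0 then
    ENNReal.ofReal (S.χ q * p * (c n).2.1 * ‖(c n).1‖ ^ (-S.α)) else 0

lemma measurable_tierInterference (S : MultiTier T) (p : ℝ) (t : Fin T) (ξ : ℝ) (q : Fin T) :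
    Measurable (S.tierInterference p t ξ q) := by
  classical
  refine Measurable.tsum fun n => Measurable.comp
    (g := fun z : Plane × ℝ × Fin (S.F q) =>
      if S.exclusionRadius t q ξ < ‖z.1‖ ∧ (z.2.2 : ℕ) = 0 then
      ENNReal.ofReal (S.χ q * p * z.2.1 * ‖z.1‖ ^ (-S.α)) else 0) ?_ (measurable_pi_apply n)
  refine Measurable.ite ?_ (by fun_prop) measurable_const
  refine MeasurableSet.inter
    (s₁ := {z : Plane × ℝ × Fin (S.F q) | S.exclusionRadius t q ξ < ‖z.1‖})
    (s₂ := {z : Plane × ℝ × Fin (S.F q) | (z.2.2 : ℕ) = 0})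
    (measurableSet_lt measurable_const measurable_fst.norm) ?_
  exact MeasurableSet.preimage (t := {j : Fin (S.F q) | (j : ℕ) = 0}) .of_discrete
    measurable_snd.snd

/-- In this form the interference is a function of the tier configurations, so the independence
assumptions on configurations carry over by composition. -/
lemma interference_eq_sum (S : MultiTier T) (p : ℝ) (t : Fin T) (ξ : ℝ) {Ω : Type*}
    (D : Deployment T S.F Ω) (ω : Ω) : S.interference p t ξ D ω =
      ∑ q, S.tierInterference p t ξ q fun n => (D.X q n ω, D.G q n ω, D.band q n ω) := rfl

variable {S : MultiTier T} {lam : ℝ} {Ω : Type*} [MeasurableSpace Ω] {P : Measure Ω}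
  {D : Deployment T S.F Ω}

lemma IsRealization.measurable_tier (h : S.IsRealization lam P D) (q : Fin T) :
    Measurable fun ω n => (D.X q n ω, D.G q n ω, D.band q n ω) :=
  measurable_pi_lambda _ fun n => ((h.poisson q).1 n).prodMk
    ((h.measurable_gain q n).prodMk (h.measurable_band q n))

/-- Laplace transform of the aggregate interference, as an integral over the plane. -/
lemma IsRealization.lintegral_expNeg_interference [IsProbabilityMeasure P]
    (h : S.IsRealization lam P D) (p : ℝ) (t : Fin T) (ξ : ℝ) (s : ℝ≥0∞) :
    ∫⁻ ω, expNeg (s * S.interference p t ξ D ω) ∂P =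
      ∏ q, expNeg (ENNReal.ofReal (S.κ q * lam) * ((S.F q : ℝ≥0∞)⁻¹ *
        ∫⁻ x in {x : Plane | S.exclusionRadius t q ξ < ‖x‖},
          ∫⁻ g, (1 - expNeg (s * ENNReal.ofReal (S.χ q * p * g * ‖x‖ ^ (-S.α))))
            ∂(S.interf q))) := by
  simp_rw [interference_eq_sum, Finset.mul_sum, expNeg_sum]
  have hm : ∀ q, Measurable fun c => expNeg (s * S.tierInterference p t ξ q c) := fun q =>
    measurable_expNeg.comp ((S.measurable_tierInterference p t ξ q).const_mul s)
  rw [lintegral_prod_eq_prod_lintegral_of_indepFun Finset.univ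
    (fun q ω => expNeg (s * S.tierInterference p t ξ q
      fun n => (D.X q n ω, D.G q n ω, D.band q n ω)))
    (h.iIndep_tiers.comp (fun q c => expNeg (s * S.tierInterference p t ξ q c)) hm)
    (fun q => (hm q).comp (h.measurable_tier q))]
  refine Finset.prod_congr rfl fun q _ => ?_
  exact (h.poisson q).lintegral_expNeg_shotNoise (S.one_le_F q) (h.measurable_gain q)
    (h.gain_law q) (h.measurable_band q) (h.band_uniform q) (h.indep_gain_band q)
    (h.iIndep_marks q) (h.indep_points_marks q) _ _ _ s

lemma IsRealization.measurable_interference (h : S.IsRealization lam P D) (p : ℝ) (t : Fin T)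
    (ξ : ℝ) : Measurable (S.interference p t ξ D) := by
  have : S.interference p t ξ D = fun ω => ∑ q, S.tierInterference p t ξ q
      fun n => (D.X q n ω, D.G q n ω, D.band q n ω) := rfl
  rw [this]
  exact Finset.measurable_sum _ fun q _ =>
    (S.measurable_tierInterference p t ξ q).comp (h.measurable_tier q)

/-- The gain of the serving link is independent of the interference. -/
lemma IsRealization.indepFun_interference (h : S.IsRealization lam P D) (p : ℝ) (t : Fin T)
    (ξ : ℝ) : IndepFun (D.g₀ t) (S.interference p t ξ D) P := by
  refine (h.indep_serving t).comp measurable_id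
    (ψ := fun c : (q : Fin T) → ℕ → Plane × ℝ × Fin (S.F q) =>
      ∑ q, S.tierInterference p t ξ q (c q)) ?_
  exact Finset.measurable_sum _ fun q _ =>
    (S.measurable_tierInterference p t ξ q).comp (measurable_pi_apply q)

end MultiTier

/-! ### The exponent as an integral over annuli -/

/-- Used to replace `1 - exp` by an integral whose order can be exchanged, both in the plane
integral and in the representation of the logarithm. -/
lemma lintegral_mul_exp_neg {k w : ℝ} (hk : 0 ≤ k) (hw : 0 ≤ w) :
    ∫⁻ v in Ioo 0 w, ENNReal.ofReal (k * Real.exp (-(k * v))) =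
      ENNReal.ofReal (1 - Real.exp (-(k * w))) := by
  have hd : ∀ v ∈ uIcc 0 w, HasDerivAt (fun v => -Real.exp (-(k * v))) (k * Real.exp (-(k * v))) v := by
    intro v _
    refine (((hasDerivAt_id v).const_mul k).neg.exp).neg.congr_deriv ?_
    simp [mul_comm]
  have hi : IntervalIntegrable (fun v => k * Real.exp (-(k * v))) volume 0 w :=
    Continuous.intervalIntegrable (by fun_prop) _ _
  rw [← ofReal_integral_eq_lintegral_ofReal, ← integral_Ioc_eq_integral_Ioo,
    ← intervalIntegral.integral_of_le hw, intervalIntegral.integral_eq_sub_of_hasDerivAt hd hi]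
  · simp [sub_eq_add_neg, add_comm]
  · exact ((intervalIntegrable_iff_integrableOn_Ioo_of_le hw).1 hi)
  · exact .of_forall fun v => by positivity

/-- The average of `∫₀¹ y g exp (-y g v) (v^(-2/α) - 1) dv` over the gain `g`. Up to a factor
`π R²`, this is the exponent of the Laplace transform of the interference of the BSs at distance
more than `R`. -/
def excess (α : ℝ) (ν : Measure ℝ) (y : ℝ) : ℝ≥0∞ :=
  ∫⁻ g, (∫⁻ v in Ioo (0 : ℝ) 1,
    ENNReal.ofReal (y * g * Real.exp (-(y * g * v))) * ENNReal.ofReal (v ^ (-(2 / α)) - 1)) ∂ν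

/-- The second condition says `‖x‖ < R v^(-1/α)`, so the set is an annulus with squared radii `R²`
and `R² v^(-2/α)`. -/
lemma volume_annulus {R α v : ℝ} (hR : 0 < R) (hα : 0 < α) (hv : v ∈ Ioo (0 : ℝ) 1) :
    volume {x : Plane | R < ‖x‖ ∧ v < (‖x‖ / R) ^ (-α)} =
      ENNReal.ofReal (Real.pi * R ^ 2) * ENNReal.ofReal (v ^ (-(2 / α)) - 1) := by
  set ρ := R * v ^ (-(1 / α)) with hρ
  have h1 : 1 ≤ v ^ (-(1 / α)) :=
    Real.one_le_rpow_of_pos_of_le_one_of_nonpos hv.1 hv.2.le (by simp [hα.le])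
  have hRρ : R ≤ ρ := le_mul_of_one_le_right hR.le h1
  have hset : {x : Plane | R < ‖x‖ ∧ v < (‖x‖ / R) ^ (-α)} =
      Metric.ball 0 ρ \ Metric.closedBall 0 R := by
    ext x
    simp only [mem_ofPred_eq, Set.mem_sdiff, Metric.mem_ball, Metric.mem_closedBall, dist_zero_right,
      not_le]
    rw [and_comm]
    refine and_congr_left fun hx => ?_
    have hx0 : 0 < ‖x‖ / R := div_pos (hR.trans hx) hR
    rw [← Real.rpow_lt_rpow_iff_of_neg (z := -(1 / α)) (Real.rpow_pos_of_pos hx0 _) hv.1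
      (by simpa using hα), ← Real.rpow_mul hx0.le]
    rw [show -α * -(1 / α) = 1 by field_simp, Real.rpow_one, div_lt_iff₀ hR, hρ, mul_comm R]
  rcases eq_or_lt_of_le hRρ with h | h
  · have hv1 : v ^ (-(1 / α)) = 1 := by
      refine le_antisymm (le_of_mul_le_mul_left ?_ hR) h1
      rw [mul_one, ← hρ, ← h]
    exact absurd hv1 (Real.one_lt_rpow_of_pos_of_lt_one_of_neg hv.1 hv.2 (by simpa using hα)).ne'
  rw [hset, measure_sdiff (Metric.closedBall_subset_ball h)
    measurableSet_closedBall.nullMeasurableSet measure_closedBall_lt_top.ne,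
    EuclideanSpace.volume_ball_fin_two, EuclideanSpace.volume_closedBall_fin_two,
    ← ENNReal.ofReal_pow hR.le,
    ← ENNReal.ofReal_pow (hR.le.trans hRρ), ← ENNReal.ofReal_mul (by positivity),
    ← ENNReal.ofReal_mul (by positivity), ← ENNReal.ofReal_sub _ (by positivity),
    ← ENNReal.ofReal_mul (by positivity)]
  congr 1
  have : v ^ (-(2 / α)) = (v ^ (-(1 / α))) ^ 2 := by
    rw [← Real.rpow_natCast, ← Real.rpow_mul hv.1.le]
    congr 1
    push_cast
    ring
  rw [hρ, this]
  ring

/-- Plane integral in the exponent of the Laplace transform of the interference. -/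
lemma lintegral_plane_eq_excess {α R k y : ℝ} (hα : 2 < α) (hR : 0 < R) (hy : 0 ≤ y)
    (hk : k = y * R ^ α) {ν : Measure ℝ} (hν : IsFadingLaw ν) :
    ∫⁻ x in {x : Plane | R < ‖x‖}, ∫⁻ g,
        (1 - expNeg (ENNReal.ofReal (k * g * ‖x‖ ^ (-α)))) ∂ν =
      ENNReal.ofReal (Real.pi * R ^ 2) * excess α ν y := by
  have := hν.isProb
  have hA : MeasurableSet {x : Plane | R < ‖x‖} := measurableSet_lt measurable_const measurable_norm
  -- Layer cake: `1 - exp (-y g w)` is the integral of `y g exp (-y g v)` over `v < w`, where `w =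
  -- (‖x‖ / R)^(-α) ≤ 1`. With an indicator in place of the bound `w`, the domain `(0, 1)` of `v`
  -- does not depend on `x`, and integrating over `x` first leaves the area of an annulus.
  set I : ℝ → Plane → ℝ → ℝ≥0∞ := fun g x v =>
    ({x : Plane | v < (‖x‖ / R) ^ (-α)}.indicator 1 x) *
      ENNReal.ofReal (y * g * Real.exp (-(y * g * v)))
  have hS : MeasurableSet {z : Plane × ℝ | z.2 < (‖z.1‖ / R) ^ (-α)} :=
    measurableSet_lt measurable_snd ((measurable_fst.norm.div_const R).pow_const _)
  have hIeq : ∀ g x v, I g x v = ({z : Plane × ℝ | z.2 < (‖z.1‖ / R) ^ (-α)}.indicator 1 (x, v)) *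
      ENNReal.ofReal (y * g * Real.exp (-(y * g * v))) := fun g x v => rfl
  have hI3 : Measurable fun z : (Plane × ℝ) × ℝ => I z.1.2 z.1.1 z.2 := by
    simp_rw [hIeq]
    refine Measurable.mul (((measurable_one.indicator hS)).comp
      (measurable_fst.fst.prodMk measurable_snd)) (by fun_prop)
  have step1 : ∀ x ∈ {x : Plane | R < ‖x‖}, ∀ g, 0 ≤ g →
      1 - expNeg (ENNReal.ofReal (k * g * ‖x‖ ^ (-α))) = ∫⁻ v in Ioo (0 : ℝ) 1, I g x v := by
    intro x hx g hg
    have hx' : R < ‖x‖ := hx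
    have hx0 : 0 < ‖x‖ := hR.trans hx'
    have hw : 0 < (‖x‖ / R) ^ (-α) := by positivity
    have hw1 : (‖x‖ / R) ^ (-α) ≤ 1 :=
      Real.rpow_le_one_of_one_le_of_nonpos ((one_le_div hR).2 hx'.le) (by linarith)
    have he : k * g * ‖x‖ ^ (-α) = y * g * (‖x‖ / R) ^ (-α) := by
      rw [hk, Real.div_rpow hx0.le hR.le, Real.rpow_neg hR.le]
      field_simp
    rw [he, one_sub_expNeg_ofReal (by positivity),
      ← lintegral_mul_exp_neg (by positivity) hw.le]
    have hset : Ioo (0 : ℝ) ((‖x‖ / R) ^ (-α)) = Ioo 0 1 ∩ Iio ((‖x‖ / R) ^ (-α)) := by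
      ext v
      simp only [mem_Ioo, mem_inter_iff, mem_Iio]
      exact ⟨fun h => ⟨⟨h.1, h.2.trans_le hw1⟩, h.2⟩, fun h => ⟨h.1.1, h.2⟩⟩
    rw [hset, inter_comm, ← Measure.restrict_restrict measurableSet_Iio,
      ← lintegral_indicator measurableSet_Iio]
    refine lintegral_congr fun v => ?_
    by_cases hv : v < (‖x‖ / R) ^ (-α) <;> simp [I, indicator, hv]
  have hIx : Measurable fun z : Plane × ℝ => ∫⁻ v in Ioo (0 : ℝ) 1, I z.2 z.1 v :=
    Measurable.lintegral_prod_right' hI3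
  calc _ = ∫⁻ x in {x : Plane | R < ‖x‖}, ∫⁻ g, (∫⁻ v in Ioo (0 : ℝ) 1, I g x v) ∂ν := by
        refine setLIntegral_congr_fun hA fun x hx => lintegral_congr_ae ?_
        filter_upwards [hν.nonneg] with g hg
        exact step1 x hx g hg
    _ = ∫⁻ g, (∫⁻ v in Ioo (0 : ℝ) 1, ∫⁻ x in {x : Plane | R < ‖x‖}, I g x v) ∂ν := by
        rw [lintegral_lintegral_swap hIx.aemeasurable]
        refine lintegral_congr fun g => lintegral_lintegral_swap ?_
        exact (hI3.comp (g := fun z : (Plane × ℝ) × ℝ => I z.1.2 z.1.1 z.2)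
          (f := fun z : Plane × ℝ => ((z.1, g), z.2)) (by fun_prop)).aemeasurable
    _ = ∫⁻ g, (∫⁻ v in Ioo (0 : ℝ) 1, ENNReal.ofReal (Real.pi * R ^ 2) *
          (ENNReal.ofReal (y * g * Real.exp (-(y * g * v))) *
            ENNReal.ofReal (v ^ (-(2 / α)) - 1))) ∂ν := by
        refine lintegral_congr fun g => setLIntegral_congr_fun measurableSet_Ioo fun v hv => ?_
        have hSv : MeasurableSet {x : Plane | v < (‖x‖ / R) ^ (-α)} :=
          hS.preimage (measurable_id.prodMk measurable_const)
        simp only [I]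
        rw [lintegral_mul_const _ (measurable_one.indicator hSv), lintegral_indicator_one hSv,
          Measure.restrict_apply hSv, inter_comm]
        have := volume_annulus hR (α := α) (by linarith) hv
        rw [show {x : Plane | R < ‖x‖} ∩ {x : Plane | v < (‖x‖ / R) ^ (-α)} =
          {x : Plane | R < ‖x‖ ∧ v < (‖x‖ / R) ^ (-α)} from rfl, this]
        ring
    _ = _ := by
        rw [excess, ← lintegral_const_mul' _ _ ENNReal.ofReal_ne_top]
        refine lintegral_congr fun g => ?_
        rw [lintegral_const_mul' _ _ ENNReal.ofReal_ne_top]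

/-! ### Transforms of fading laws -/

/-- A single term of the exponential series is at most its sum. The bound is uniform in `g`, so the
damped moments in `TcalTerm` exist although only the mean of the gain is assumed finite. -/
lemma pow_mul_exp_neg_le {y g : ℝ} (hy : 0 < y) (hg : 0 ≤ g) (k : ℕ) :
    g ^ k * Real.exp (-(y * g)) ≤ k.factorial / y ^ k := by
  have h := Real.pow_div_factorial_le_exp (y * g) (by positivity) k
  have hk : (0 : ℝ) < k.factorial := by positivity
  rw [div_le_iff₀ hk, mul_pow] at h
  rw [Real.exp_neg, ← div_eq_mul_inv, div_le_div_iff₀ (Real.exp_pos _) (by positivity)]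
  linarith

lemma IsFadingLaw.integrable_pow_mul_exp_neg {ν : Measure ℝ} (hν : IsFadingLaw ν) {y : ℝ}
    (hy : 0 < y) (k : ℕ) : Integrable (fun x : ℝ => x ^ k * Real.exp (-(y * x))) ν := by
  have := hν.isProb
  refine Integrable.of_bound (by fun_prop) (k.factorial / y ^ k) ?_
  filter_upwards [hν.nonneg] with x hx
  rw [Real.norm_of_nonneg (by positivity)]
  exact pow_mul_exp_neg_le hy hx k

lemma IsFadingLaw.integrable_exp_neg {ν : Measure ℝ} (hν : IsFadingLaw ν) {y : ℝ} (hy : 0 ≤ y) :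
    Integrable (fun x : ℝ => Real.exp (-(y * x))) ν := by
  have := hν.isProb
  refine Integrable.of_bound (by fun_prop) 1 ?_
  filter_upwards [hν.nonneg] with x hx
  rw [Real.norm_of_nonneg (Real.exp_nonneg _), Real.exp_le_one_iff]
  nlinarith

lemma IsFadingLaw.lintegral_one_sub_exp_neg {ν : Measure ℝ} (hν : IsFadingLaw ν) {y : ℝ}
    (hy : 0 ≤ y) :
    ∫⁻ g, ENNReal.ofReal (1 - Real.exp (-(y * g))) ∂ν = ENNReal.ofReal (1 - mgfNeg ν y) := by
  have := hν.isProb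
  rw [← ofReal_integral_eq_lintegral_ofReal (f := fun g => 1 - Real.exp (-(y * g)))
    ((integrable_const 1).sub (hν.integrable_exp_neg hy)), integral_sub (integrable_const 1) (hν.integrable_exp_neg hy)]
  · simp [mgfNeg]
  · filter_upwards [hν.nonneg] with x hx
    have : Real.exp (-(y * x)) ≤ 1 := Real.exp_le_one_iff.2 (by nlinarith)
    simpa using this

lemma IsFadingLaw.mgfNeg_le_one {ν : Measure ℝ} (hν : IsFadingLaw ν) {y : ℝ} (hy : 0 ≤ y) :
    mgfNeg ν y ≤ 1 := by
  have := hν.isProb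
  calc mgfNeg ν y ≤ ∫ _, (1 : ℝ) ∂ν := by
        refine integral_mono_ae (hν.integrable_exp_neg hy) (integrable_const _) ?_
        filter_upwards [hν.nonneg] with x hx
        exact Real.exp_le_one_iff.2 (by nlinarith)
    _ = 1 := by simp

lemma mgfNeg_nonneg (ν : Measure ℝ) (y : ℝ) : 0 ≤ mgfNeg ν y :=
  integral_nonneg fun _ => Real.exp_nonneg _

/-- From `exp (-x) ≥ 1 - x` and mean one; it cancels the `1 / z` of the limiting integrand near `0`.
-/
lemma IsFadingLaw.one_sub_mgfNeg_le {ν : Measure ℝ} (hν : IsFadingLaw ν) {y : ℝ} (hy : 0 ≤ y) :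
    1 - mgfNeg ν y ≤ y := by
  have := hν.isProb
  have h : ∫ x, (1 - y * x) ∂ν ≤ mgfNeg ν y := by
    refine integral_mono ((integrable_const 1).sub (hν.integrable.const_mul y))
      (hν.integrable_exp_neg hy) fun x => ?_
    have := Real.add_one_le_exp (-(y * x))
    simp only
    linarith
  rw [integral_sub (integrable_const 1) (hν.integrable.const_mul y), integral_const_mul,
    hν.mean_one] at h
  simp at h
  linarith

lemma measurable_mgfNeg (ν : Measure ℝ) [SFinite ν] : Measurable (mgfNeg ν) := by
  refine StronglyMeasurable.measurable ?_
  exact StronglyMeasurable.integral_prod_right (f := fun s x : ℝ => Real.exp (-(s * x)))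
    (Measurable.stronglyMeasurable (by fun_prop))

/-! ### The series `Tcal` as an integral -/

/-- The beta integral `B(a, k + 1)`, read off from the total mass one of the beta density. -/
lemma lintegral_rpow_mul_one_sub_pow {a : ℝ} (ha : 0 < a) (k : ℕ) :
    ∫⁻ v in Ioo (0 : ℝ) 1, ENNReal.ofReal (v ^ (a - 1) * (1 - v) ^ k) =
      ENNReal.ofReal (Real.Gamma a * k.factorial / Real.Gamma (a + 1 + k)) := by
  have hb : 0 < beta a (k + 1) := beta_pos ha (by positivity)
  have h := lintegral_betaPDF_eq_one ha (show (0 : ℝ) < k + 1 by positivity)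
  rw [lintegral_betaPDF] at h
  have h2 : ∀ v : ℝ, ENNReal.ofReal (1 / beta a (k + 1) * v ^ (a - 1) * (1 - v) ^ ((k : ℝ) + 1 - 1)) =
      ENNReal.ofReal (1 / beta a (k + 1)) * ENNReal.ofReal (v ^ (a - 1) * (1 - v) ^ k) := by
    intro v
    rw [← ENNReal.ofReal_mul (by positivity), add_sub_cancel_right, Real.rpow_natCast, mul_assoc]
  simp_rw [h2] at h
  rw [lintegral_const_mul' _ _ ENNReal.ofReal_ne_top, one_div, ENNReal.ofReal_inv_of_pos hb] at h
  have h3 : ∫⁻ v in Ioo (0 : ℝ) 1, ENNReal.ofReal (v ^ (a - 1) * (1 - v) ^ k) =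
      ENNReal.ofReal (beta a (k + 1)) := by
    rw [mul_comm] at h
    have := ENNReal.eq_inv_of_mul_eq_one_left h
    rwa [inv_inv] at this
  rw [h3, beta, Real.Gamma_nat_eq_factorial]
  congr 3
  ring

lemma lintegral_rpow_Ioo_lt_top {a : ℝ} (ha : 0 < a) :
    ∫⁻ v in Ioo (0 : ℝ) 1, ENNReal.ofReal (v ^ (a - 1)) < ∞ := by
  have := lintegral_rpow_mul_one_sub_pow ha 0
  simp only [pow_zero, mul_one] at this
  rw [this]
  exact ENNReal.ofReal_lt_top

/-- The lower incomplete gamma function as a power series. -/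
lemma lintegral_mul_exp_neg_mul_rpow {a x : ℝ} (ha : 0 < a) (hx : 0 ≤ x) :
    ∫⁻ v in Ioo (0 : ℝ) 1, ENNReal.ofReal (x * Real.exp (-(x * v)) * v ^ (a - 1)) =
      ∑' k : ℕ, ENNReal.ofReal (Real.Gamma a * (x ^ (k + 1) * Real.exp (-x)) *
        (Real.Gamma (a + 1 + k))⁻¹) := by
  -- Writing `exp (-x v) = exp (-x) exp (x (1 - v))` and expanding the last factor keeps all terms
  -- nonnegative, so termwise integration is free, and each term is a beta integral.
  have h1 : ∀ v ∈ Ioo (0 : ℝ) 1, ENNReal.ofReal (x * Real.exp (-(x * v)) * v ^ (a - 1)) =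
      ∑' k : ℕ, ENNReal.ofReal (x ^ (k + 1) * Real.exp (-x) / k.factorial) *
        ENNReal.ofReal (v ^ (a - 1) * (1 - v) ^ k) := by
    intro v hv
    have hv1 : 0 ≤ 1 - v := by linarith [hv.2]
    have hv0 : 0 ≤ v ^ (a - 1) := Real.rpow_nonneg hv.1.le _
    have hs : HasSum (fun k : ℕ => x ^ (k + 1) * Real.exp (-x) / k.factorial *
        (v ^ (a - 1) * (1 - v) ^ k)) (x * Real.exp (-(x * v)) * v ^ (a - 1)) := by
      have h := (NormedSpace.expSeries_div_hasSum_exp (x * (1 - v))).mul_left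
        (x * Real.exp (-x) * v ^ (a - 1))
      rw [← Real.exp_eq_exp_ℝ] at h
      have he : x * Real.exp (-x) * v ^ (a - 1) * Real.exp (x * (1 - v)) =
          x * Real.exp (-(x * v)) * v ^ (a - 1) := by
        rw [show -(x * v) = -x + x * (1 - v) by ring, Real.exp_add]
        ring
      rw [he] at h
      have hf : (fun k : ℕ => x ^ (k + 1) * Real.exp (-x) / k.factorial *
          (v ^ (a - 1) * (1 - v) ^ k)) = fun k : ℕ => x * Real.exp (-x) * v ^ (a - 1) *
            ((x * (1 - v)) ^ k / k.factorial) := by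
        ext k
        rw [mul_pow, pow_succ]
        ring
      rw [hf]
      exact h
    simp_rw [← ENNReal.ofReal_mul (show (0 : ℝ) ≤ x ^ (_ + 1) * Real.exp (-x) /
      (Nat.factorial _ : ℝ) by positivity)]
    rw [← ENNReal.ofReal_tsum_of_nonneg (fun k => by positivity) hs.summable, hs.tsum_eq]
  rw [setLIntegral_congr_fun measurableSet_Ioo h1, lintegral_tsum]
  · refine tsum_congr fun k => ?_
    have hG : 0 < Real.Gamma (a + 1 + k) := Real.Gamma_pos_of_pos (by positivity)
    rw [lintegral_const_mul' _ _ ENNReal.ofReal_ne_top, lintegral_rpow_mul_one_sub_pow ha,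
      ← ENNReal.ofReal_mul (by positivity)]
    congr 1
    field_simp
  · intro k
    exact (Measurable.const_mul (by fun_prop) _).aemeasurable

/-- The integral represented by the series `Tcal`. -/
def gammaAverage (α : ℝ) (ν : Measure ℝ) (y : ℝ) : ℝ≥0∞ :=
  ∫⁻ g, (∫⁻ v in Ioo (0 : ℝ) 1,
    ENNReal.ofReal (y * g * Real.exp (-(y * g * v)) * v ^ (-(2 / α)))) ∂ν

/-- Dropping the exponential leaves the finite mean `y E g` times the integral of `v^(-2/α)` over
`(0, 1)`, which is finite because `α > 2`. -/
lemma gammaAverage_lt_top {α : ℝ} (hα : 2 < α) {ν : Measure ℝ} (hν : IsFadingLaw ν) {y : ℝ}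
    (hy : 0 ≤ y) : gammaAverage α ν y < ∞ := by
  have ha : 0 < 1 - 2 / α := by
    rw [sub_pos, div_lt_one (by linarith)]
    exact hα
  calc gammaAverage α ν y ≤ ∫⁻ g, (∫⁻ v in Ioo (0 : ℝ) 1,
        ENNReal.ofReal (y * g) * ENNReal.ofReal (v ^ (1 - 2 / α - 1))) ∂ν := by
        refine lintegral_mono_ae ?_
        filter_upwards [hν.nonneg] with g hg
        refine setLIntegral_mono' measurableSet_Ioo fun v hv => ?_
        rw [← ENNReal.ofReal_mul (by positivity), show 1 - 2 / α - 1 = -(2 / α) by ring]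
        refine ENNReal.ofReal_le_ofReal (mul_le_mul_of_nonneg_right ?_ (Real.rpow_nonneg hv.1.le _))
        refine mul_le_of_le_one_right (by positivity) (Real.exp_le_one_iff.2 ?_)
        have := hv.1
        simp only [Left.neg_nonpos_iff]
        positivity
    _ = (∫⁻ g, ENNReal.ofReal (y * g) ∂ν) *
        ∫⁻ v in Ioo (0 : ℝ) 1, ENNReal.ofReal (v ^ (1 - 2 / α - 1)) := by
        simp_rw [lintegral_const_mul' _ _ ENNReal.ofReal_ne_top]
        rw [lintegral_mul_const' _ _ (lintegral_rpow_Ioo_lt_top ha).ne]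
    _ < ∞ := ENNReal.mul_lt_top (hν.integrable.const_mul y).lintegral_lt_top
        (lintegral_rpow_Ioo_lt_top ha)

lemma gammaAverage_eq_tsum {α : ℝ} (hα : 2 < α) {ν : Measure ℝ} (hν : IsFadingLaw ν) {y : ℝ}
    (hy : 0 < y) : gammaAverage α ν y =
      ∑' k : ℕ, ENNReal.ofReal (Real.Gamma (1 - 2 / α) * TcalTerm α ν y k) := by
  have ha : 0 < 1 - 2 / α := by
    rw [sub_pos, div_lt_one (by linarith)]
    exact hα
  have h1 : gammaAverage α ν y = ∫⁻ g, ∑' k : ℕ, ENNReal.ofReal (Real.Gamma (1 - 2 / α) *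
      ((y * g) ^ (k + 1) * Real.exp (-(y * g))) * (Real.Gamma (1 - 2 / α + 1 + k))⁻¹) ∂ν := by
    refine lintegral_congr_ae ?_
    filter_upwards [hν.nonneg] with g hg
    rw [← lintegral_mul_exp_neg_mul_rpow ha (by positivity)]
    simp_rw [show 1 - 2 / α - 1 = -(2 / α) by ring]
  rw [h1, lintegral_tsum fun k => (by fun_prop)]
  refine tsum_congr fun k => ?_
  have hG : 0 < Real.Gamma (1 - 2 / α + 1 + k) := Real.Gamma_pos_of_pos (by positivity)
  have h2 : ∀ g : ℝ, Real.Gamma (1 - 2 / α) * ((y * g) ^ (k + 1) * Real.exp (-(y * g))) *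
      (Real.Gamma (1 - 2 / α + 1 + k))⁻¹ = Real.Gamma (1 - 2 / α) * y ^ (k + 1) *
      (Real.Gamma (1 - 2 / α + 1 + k))⁻¹ * (g ^ (k + 1) * Real.exp (-(y * g))) := by
    intro g
    rw [mul_pow]
    ring
  simp_rw [h2]
  rw [← ofReal_integral_eq_lintegral_ofReal ((hν.integrable_pow_mul_exp_neg hy _).const_mul _),
    integral_const_mul, TcalTerm]
  · congr 1
    rw [show 2 - 2 / α + (k : ℝ) = 1 - 2 / α + 1 + k by ring]
    ring
  · filter_upwards [hν.nonneg] with g hg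
    have := Real.Gamma_pos_of_pos ha
    simp only [Pi.zero_apply]
    positivity

lemma IsFadingLaw.TcalTerm_nonneg {α : ℝ} (hα : 2 < α) {ν : Measure ℝ} (hν : IsFadingLaw ν) {y : ℝ}
    (hy : 0 ≤ y) (k : ℕ) : 0 ≤ TcalTerm α ν y k := by
  have ha : 0 < 1 - 2 / α := by
    rw [sub_pos, div_lt_one (by linarith)]
    exact hα
  have hG : 0 < Real.Gamma (2 - 2 / α + k) :=
    Real.Gamma_pos_of_pos (by have : (0 : ℝ) ≤ k := k.cast_nonneg; linarith)
  have hi : 0 ≤ ∫ x, x ^ (k + 1) * Real.exp (-(y * x)) ∂ν := by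
    refine integral_nonneg_of_ae ?_
    filter_upwards [hν.nonneg] with g hg
    simp only [Pi.zero_apply]
    positivity
  unfold TcalTerm
  positivity

/-- The terms are nonnegative and, up to the factor `Γ(1 - 2/α)`, sum in `[0, ∞]` to a finite
`gammaAverage`. -/
lemma IsFadingLaw.summable_TcalTerm {α : ℝ} (hα : 2 < α) {ν : Measure ℝ} (hν : IsFadingLaw ν)
    {y : ℝ} (hy : 0 < y) : Summable (TcalTerm α ν y) := by
  have hG : 0 < Real.Gamma (1 - 2 / α) := Real.Gamma_pos_of_pos (by
    rw [sub_pos, div_lt_one (by linarith)]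
    exact hα)
  have h := gammaAverage_lt_top hα hν hy.le
  rw [gammaAverage_eq_tsum hα hν hy] at h
  have := ENNReal.summable_toReal h.ne
  simp_rw [ENNReal.toReal_ofReal (mul_nonneg hG.le (hν.TcalTerm_nonneg hα hy.le _))] at this
  exact (summable_mul_left_iff hG.ne').1 this

lemma IsFadingLaw.gammaAverage_eq {α : ℝ} (hα : 2 < α) {ν : Measure ℝ} (hν : IsFadingLaw ν)
    {y : ℝ} (hy : 0 < y) : gammaAverage α ν y = ENNReal.ofReal (Tcal α ν y) := by
  have hG : 0 < Real.Gamma (1 - 2 / α) := Real.Gamma_pos_of_pos (by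
    rw [sub_pos, div_lt_one (by linarith)]
    exact hα)
  rw [gammaAverage_eq_tsum hα hν hy, ← ENNReal.ofReal_tsum_of_nonneg
    (fun k => mul_nonneg hG.le (hν.TcalTerm_nonneg hα hy.le _))
    ((hν.summable_TcalTerm hα hy).mul_left _), tsum_mul_left, Tcal]

lemma IsFadingLaw.Tcal_nonneg {α : ℝ} (hα : 2 < α) {ν : Measure ℝ} (hν : IsFadingLaw ν)
    {y : ℝ} (hy : 0 < y) : 0 ≤ Tcal α ν y := by
  have hG : 0 < Real.Gamma (1 - 2 / α) := Real.Gamma_pos_of_pos (by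
    rw [sub_pos, div_lt_one (by linarith)]
    exact hα)
  exact mul_nonneg hG.le (tsum_nonneg (hν.TcalTerm_nonneg hα hy.le))

/-- Split `v^(-2/α) = (v^(-2/α) - 1) + 1`; the last summand integrates to `1 - exp (-y g)`. The
additive form avoids truncated subtraction. -/
lemma IsFadingLaw.excess_add {α : ℝ} (hα : 2 < α) {ν : Measure ℝ} (hν : IsFadingLaw ν)
    {y : ℝ} (hy : 0 < y) :
    excess α ν y + ENNReal.ofReal (1 - mgfNeg ν y) = ENNReal.ofReal (Tcal α ν y) := by
  rw [← hν.gammaAverage_eq hα hy, ← hν.lintegral_one_sub_exp_neg hy.le, excess,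
    ← lintegral_add_right _ (by fun_prop), gammaAverage]
  refine lintegral_congr_ae ?_
  filter_upwards [hν.nonneg] with g hg
  have h1 := lintegral_mul_exp_neg (show 0 ≤ y * g by positivity) zero_le_one
  rw [mul_one] at h1
  rw [← h1, ← lintegral_add_right _ (by fun_prop)]
  refine setLIntegral_congr_fun measurableSet_Ioo fun v hv => ?_
  have hv1 : 1 ≤ v ^ (-(2 / α)) := Real.one_le_rpow_of_pos_of_le_one_of_nonpos hv.1 hv.2.le
    (by simp only [Left.neg_nonpos_iff]; positivity)
  rw [← ENNReal.ofReal_mul (by positivity), ← ENNReal.ofReal_add _ (by positivity)]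
  · congr 1
    ring
  · exact mul_nonneg (by positivity) (by linarith)

lemma IsFadingLaw.excess_eq {α : ℝ} (hα : 2 < α) {ν : Measure ℝ} (hν : IsFadingLaw ν)
    {y : ℝ} (hy : 0 < y) :
    excess α ν y = ENNReal.ofReal (mgfNeg ν y + Tcal α ν y - 1) := by
  have h := hν.excess_add hα hy
  have h1 := ENNReal.eq_sub_of_add_eq ENNReal.ofReal_ne_top h
  rw [h1, ← ENNReal.ofReal_sub _ (by linarith [hν.mgfNeg_le_one hy.le])]
  congr 1
  ring

/-- This is nonnegativity of `excess`. It cannot be read off `excess_eq`, whose `ENNReal.ofReal`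
would hide a negative argument. -/
lemma IsFadingLaw.one_le_mgfNeg_add_Tcal {α : ℝ} (hα : 2 < α) {ν : Measure ℝ} (hν : IsFadingLaw ν)
    {y : ℝ} (hy : 0 < y) : 1 ≤ mgfNeg ν y + Tcal α ν y := by
  have h := hν.excess_add hα hy
  have h1 : ENNReal.ofReal (1 - mgfNeg ν y) ≤ ENNReal.ofReal (Tcal α ν y) := h ▸ le_add_self
  rw [ENNReal.ofReal_le_ofReal_iff (hν.Tcal_nonneg hα hy)] at h1
  linarith

lemma measurable_excess (α : ℝ) (ν : Measure ℝ) [SFinite ν] : Measurable (excess α ν) := by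
  refine Measurable.lintegral_prod_right' (f := fun z : ℝ × ℝ => ∫⁻ v in Ioo (0 : ℝ) 1,
    ENNReal.ofReal (z.1 * z.2 * Real.exp (-(z.1 * z.2 * v))) *
      ENNReal.ofReal (v ^ (-(2 / α)) - 1)) ?_
  exact Measurable.lintegral_prod_right' (f := fun z : (ℝ × ℝ) × ℝ =>
    ENNReal.ofReal (z.1.1 * z.1.2 * Real.exp (-(z.1.1 * z.1.2 * z.2))) *
      ENNReal.ofReal (z.2 ^ (-(2 / α)) - 1)) (by fun_prop)

/-! ### Growth of the transforms at infinity -/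

lemma IsFadingLaw.exists_measure_pos {ν : Measure ℝ} (hν : IsFadingLaw ν) :
    ∃ δ > 0, 0 < ν (Ici δ) := by
  by_contra! hn
  have h0 : ∀ᵐ x ∂ν, x ≤ 0 := by
    have : ∀ n : ℕ, ∀ᵐ x ∂ν, x < 1 / ((n : ℝ) + 1) := fun n => by
      have := hn (1 / ((n : ℝ) + 1)) (by positivity)
      rw [ae_iff]
      convert nonpos_iff_eq_zero.1 this using 2
      ext x
      simp
    filter_upwards [ae_all_iff.2 this] with x hx
    exact ge_of_tendsto' tendsto_one_div_add_atTop_nhds_zero_nat fun n => (hx n).le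
  have h1 := integral_nonpos_of_ae (μ := ν) (f := fun x : ℝ => x) h0
  rw [hν.mean_one] at h1
  linarith

/-- Growth of `mgfNeg + Tcal` at infinity. -/
lemma IsFadingLaw.exists_le_mgfNeg_add_Tcal {α : ℝ} (hα : 2 < α) {ν : Measure ℝ}
    (hν : IsFadingLaw ν) :
    ∃ c > 0, ∀ y, 0 < y → c * y ^ (2 / α) ≤ mgfNeg ν y + Tcal α ν y := by
  have := hν.isProb
  obtain ⟨δ, hδ, hpos⟩ := hν.exists_measure_pos
  -- `exp (-1)` bounds `exp (-y g v)` from below for `v < 1 / (y g)`. With `w = (δ y)^(2/α)`, the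
  -- aim is `mgfNeg + Tcal ≥ 1 + p (w - 1)` when `δ y ≥ 1`, which is at least `p w` since `p ≤ 1`.
  set p := (ν (Ici δ)).toReal * Real.exp (-1)
  have hp0 : 0 < p := mul_pos (ENNReal.toReal_pos hpos.ne' (measure_ne_top _ _)) (Real.exp_pos _)
  have hp1 : p ≤ 1 := mul_le_one₀ (ENNReal.toReal_le_of_le_ofReal zero_le_one
    (by simpa using prob_le_one)) (Real.exp_nonneg _) (Real.exp_le_one_iff.2 (by norm_num))
  refine ⟨p * δ ^ (2 / α), by positivity, fun y hy => ?_⟩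
  have h1 := hν.one_le_mgfNeg_add_Tcal hα hy
  rw [mul_assoc, ← Real.mul_rpow hδ.le hy.le]
  have h2α : 0 < 2 / α := by positivity
  rcases le_total (δ * y) 1 with hsmall | hlarge
  · have := Real.rpow_le_one (by positivity) hsmall h2α.le
    nlinarith [Real.rpow_nonneg (show 0 ≤ δ * y by positivity) (2 / α)]
  have hbig : ENNReal.ofReal (p * ((δ * y) ^ (2 / α) - 1)) ≤ excess α ν y := by
    have hx1 : 1 ≤ (δ * y) ^ (2 / α) := Real.one_le_rpow hlarge h2α.le
    calc ENNReal.ofReal (p * ((δ * y) ^ (2 / α) - 1))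
        = ∫⁻ g in Ici δ, ENNReal.ofReal (Real.exp (-1) * ((δ * y) ^ (2 / α) - 1)) ∂ν := by
          rw [lintegral_const, Measure.restrict_apply_univ, mul_comm,
            ← ENNReal.ofReal_toReal (measure_ne_top ν (Ici δ)), ← ENNReal.ofReal_mul (by positivity)]
          congr 1
          simp only [p]
          ring
      _ ≤ ∫⁻ g in Ici δ, (∫⁻ v in Ioo (0 : ℝ) 1,
          ENNReal.ofReal (y * g * Real.exp (-(y * g * v))) *
            ENNReal.ofReal (v ^ (-(2 / α)) - 1)) ∂ν := by
          refine setLIntegral_mono' measurableSet_Ici fun g hg => ?_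
          have hg' : δ ≤ g := hg
          have hx : δ * y ≤ y * g := by nlinarith
          have hx0 : 0 < y * g := by linarith
          have hx1 : 1 / (y * g) ≤ 1 := by
            rw [div_le_one hx0]
            linarith
          -- Only `v < 1 / (y g)` is kept: the length of this interval cancels the factor `y g`, and
          -- there `v^(-2/α)` exceeds `(y g)^(2/α) ≥ (δ y)^(2/α)`.
          calc ENNReal.ofReal (Real.exp (-1) * ((δ * y) ^ (2 / α) - 1))
              = ∫⁻ v in Ioo (0 : ℝ) (1 / (y * g)),
                ENNReal.ofReal (y * g * (Real.exp (-1) * ((δ * y) ^ (2 / α) - 1))) := by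
                rw [lintegral_const, Measure.restrict_apply_univ, Real.volume_Ioo,
                  sub_zero,
                  ← ENNReal.ofReal_mul' (by positivity)]
                congr 1
                rw [mul_comm (y * g), mul_assoc _ (y * g), mul_one_div_cancel hx0.ne', mul_one]
            _ ≤ ∫⁻ v in Ioo (0 : ℝ) (1 / (y * g)),
                ENNReal.ofReal (y * g * Real.exp (-(y * g * v))) *
                  ENNReal.ofReal (v ^ (-(2 / α)) - 1) := by
                refine setLIntegral_mono' measurableSet_Ioo fun v hv => ?_
                rw [← ENNReal.ofReal_mul (by positivity), ← mul_assoc (y * g)]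
                have hvx : y * g * v ≤ 1 := by
                  have := hv.2
                  rw [lt_div_iff₀ hx0] at this
                  linarith
                have hvr : (δ * y) ^ (2 / α) ≤ v ^ (-(2 / α)) := by
                  rw [Real.rpow_neg hv.1.le, ← Real.inv_rpow hv.1.le]
                  refine Real.rpow_le_rpow (by positivity) ?_ h2α.le
                  rw [le_inv_comm₀ (by linarith) hv.1]
                  refine hv.2.le.trans ?_
                  rw [one_div]
                  exact inv_anti₀ (by linarith) hx
                exact ENNReal.ofReal_le_ofReal (mul_le_mul
                  (mul_le_mul_of_nonneg_left (Real.exp_le_exp.2 (by linarith)) hx0.le)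
                  (by linarith) (by linarith) (by positivity))
            _ ≤ _ := lintegral_mono_set (Ioo_subset_Ioo_right hx1)
      _ ≤ _ := setLIntegral_le_lintegral _ _
  rw [hν.excess_eq hα hy, ENNReal.ofReal_le_ofReal_iff (by linarith)] at hbig
  linarith

/-! ### Integral representation of the logarithm -/

lemma lintegral_exp_neg_mul_Ioi {b : ℝ} (hb : 0 < b) :
    ∫⁻ z in Ioi (0 : ℝ), ENNReal.ofReal (Real.exp (-(b * z))) = ENNReal.ofReal b⁻¹ := by
  have h1 := integrableOn_exp_mul_Ioi (a := -b) (by linarith) 0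
  have h2 := integral_exp_mul_Ioi (a := -b) (by linarith) 0
  simp_rw [neg_mul] at h1 h2
  rw [← ofReal_integral_eq_lintegral_ofReal h1 (.of_forall fun z => Real.exp_nonneg _), h2]
  congr 1
  simp

lemma lintegral_inv_add {s n : ℝ} (hs : 0 ≤ s) (hn : 0 < n) :
    ∫⁻ τ in Ioo (0 : ℝ) s, ENNReal.ofReal (τ + n)⁻¹ = ENNReal.ofReal (Real.log (1 + s / n)) := by
  have hc : ContinuousOn (fun τ : ℝ => (τ + n)⁻¹) (uIcc 0 s) := by
    refine ContinuousOn.inv₀ (by fun_prop) fun τ hτ => ?_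
    rw [uIcc_of_le hs] at hτ
    linarith [hτ.1]
  have hi := (intervalIntegrable_iff_integrableOn_Ioo_of_le hs).1
    (hc.intervalIntegrable (μ := volume))
  rw [← ofReal_integral_eq_lintegral_ofReal hi, ← integral_Ioc_eq_integral_Ioo,
    ← intervalIntegral.integral_of_le hs,
    intervalIntegral.integral_comp_add_right (fun τ => τ⁻¹), zero_add,
    integral_inv_of_pos hn (by linarith)]
  · congr 2
    field_simp
    ring
  · filter_upwards [ae_restrict_mem measurableSet_Ioo] with τ hτ
    have := hτ.1
    simp only [Pi.zero_apply]
    positivity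

/-- Integral representation of `log (1 + s / n)`. -/
lemma ofReal_log_one_add_div {s : ℝ} (hs : 0 ≤ s) {n : ℝ≥0∞} (hn : n ≠ 0) :
    ENNReal.ofReal (Real.log (1 + (ENNReal.ofReal s / n).toReal)) =
      ∫⁻ z in Ioi (0 : ℝ),
        ENNReal.ofReal ((1 - Real.exp (-(z * s))) / z) * expNeg (ENNReal.ofReal z * n) := by
  rcases eq_or_ne n ∞ with rfl | hn'
  · have : ∀ z ∈ Ioi (0 : ℝ), ENNReal.ofReal ((1 - Real.exp (-(z * s))) / z) *
        expNeg (ENNReal.ofReal z * ∞) = 0 := fun z hz => by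
      rw [ENNReal.mul_top (by simpa using hz), expNeg_top, mul_zero]
    rw [setLIntegral_congr_fun measurableSet_Ioi this]
    simp
  obtain ⟨n, rfl⟩ : ∃ x : ℝ, n = ENNReal.ofReal x := ⟨_, (ENNReal.ofReal_toReal hn').symm⟩
  have hn0 : 0 < n := by simpa using hn
  rw [← ENNReal.ofReal_div_of_pos hn0, ENNReal.toReal_ofReal (by positivity),
    ← lintegral_inv_add hs hn0]
  -- `(1 - exp (-z s)) / z` is the integral of `exp (-z τ)` over `τ < s`. Integrating over `z` first
  -- then gives `1 / (τ + n)`.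
  have h1 : ∀ z ∈ Ioi (0 : ℝ), ENNReal.ofReal ((1 - Real.exp (-(z * s))) / z) *
      expNeg (ENNReal.ofReal z * ENNReal.ofReal n) =
        ∫⁻ τ in Ioo (0 : ℝ) s, ENNReal.ofReal (Real.exp (-((τ + n) * z))) := by
    intro z hz
    have hz : 0 < z := hz
    rw [← ENNReal.ofReal_mul hz.le, expNeg_ofReal (by positivity), div_eq_mul_inv,
      ENNReal.ofReal_mul' (by positivity), ← lintegral_mul_exp_neg hz.le hs, mul_assoc, mul_comm,
      ← lintegral_const_mul' _ _ (by finiteness)]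
    refine lintegral_congr fun τ => ?_
    rw [← ENNReal.ofReal_mul (by positivity), ← ENNReal.ofReal_mul (by positivity)]
    congr 1
    rw [show -((τ + n) * z) = -(z * n) + -(z * τ) by ring, Real.exp_add]
    field_simp
  rw [setLIntegral_congr_fun measurableSet_Ioi h1, lintegral_lintegral_swap (by fun_prop)]
  refine setLIntegral_congr_fun measurableSet_Ioo fun τ hτ => ?_
  exact (lintegral_exp_neg_mul_Ioi (by linarith [hτ.1])).symm

/-! ### Laplace transform of the interference and conditional rate -/

namespace MultiTier

variable {T : ℕ}

lemma biasRatio_pos (S : MultiTier T) (t q : Fin T) : 0 < S.biasRatio t q :=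
  mul_pos (div_pos (S.χ_pos q) (S.χ_pos t)) (div_pos (S.B_pos q) (S.B_pos t))

/-- The argument at which the transforms of tier `q` are evaluated in `Ztilde`. -/
def tierArg (S : MultiTier T) (t q : Fin T) (z : ℝ) : ℝ :=
  (S.biasRatio t q)⁻¹ * (S.χ q / S.χ t) * z

lemma tierArg_pos (S : MultiTier T) (t q : Fin T) {z : ℝ} (hz : 0 < z) : 0 < S.tierArg t q z :=
  mul_pos (mul_pos (inv_pos.2 (S.biasRatio_pos t q)) (div_pos (S.χ_pos q) (S.χ_pos t))) hz

lemma tierArg_self (S : MultiTier T) (t : Fin T) (z : ℝ) : S.tierArg t t z = z := by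
  have h1 := (S.χ_pos t).ne'
  have h2 := (S.B_pos t).ne'
  simp [tierArg, biasRatio, h1, h2]

lemma F_pos (S : MultiTier T) (q : Fin T) : (0 : ℝ) < S.F q :=
  Nat.cast_pos.2 (S.one_le_F q)

lemma one_le_F_cast (S : MultiTier T) (q : Fin T) : (1 : ℝ) ≤ S.F q :=
  Nat.one_le_cast.2 (S.one_le_F q)

/-- Density of the co-channel BSs of the serving tier, times `π`. -/
def bandDensity (S : MultiTier T) (lam : ℝ) (t : Fin T) : ℝ := Real.pi * (S.κ t * lam / S.F t)

lemma bandDensity_pos (S : MultiTier T) {lam : ℝ} (hlam : 0 < lam) (t : Fin T) :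
    0 < S.bandDensity lam t :=
  mul_pos Real.pi_pos (div_pos (mul_pos (S.κ_pos t) hlam) (S.F_pos t))

lemma exclusionRadius_pos (S : MultiTier T) (t q : Fin T) {ξ : ℝ} (hξ : 0 < ξ) :
    0 < S.exclusionRadius t q ξ :=
  mul_pos (Real.rpow_pos_of_pos (S.biasRatio_pos t q) _) hξ

lemma α_pos (S : MultiTier T) : 0 < S.α := two_pos.trans S.two_lt_α

lemma exclusionRadius_rpow (S : MultiTier T) (t q : Fin T) {ξ : ℝ} (hξ : 0 < ξ) :
    S.exclusionRadius t q ξ ^ S.α = S.biasRatio t q * ξ ^ S.α := by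
  have h := (S.biasRatio_pos t q).le
  rw [exclusionRadius, Real.mul_rpow (Real.rpow_nonneg h _) hξ.le, ← Real.rpow_mul h,
    one_div_mul_cancel S.α_pos.ne', Real.rpow_one]

lemma exclusionRadius_sq (S : MultiTier T) (t q : Fin T) (ξ : ℝ) :
    S.exclusionRadius t q ξ ^ 2 = S.biasRatio t q ^ (2 / S.α) * ξ ^ 2 := by
  have h := (S.biasRatio_pos t q).le
  rw [exclusionRadius, mul_pow, ← Real.rpow_natCast, ← Real.rpow_mul h]
  congr 2
  push_cast
  ring

lemma one_le_transform (S : MultiTier T) (t q : Fin T) {z : ℝ} (hz : 0 < z) :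
    1 ≤ mgfNeg (S.interf q) (S.tierArg t q z) + Tcal S.α (S.interf q) (S.tierArg t q z) :=
  (S.interf_law q).one_le_mgfNeg_add_Tcal S.two_lt_α (S.tierArg_pos t q hz)

lemma Ztilde_eq (S : MultiTier T) (t : Fin T) (z : ℝ) : S.Ztilde t z =
    ∑ q, (S.κ q / S.F q * (S.F t / S.κ t)) * S.biasRatio t q ^ (2 / S.α) *
      (((S.F q : ℝ) - 1) + mgfNeg (S.interf q) (S.tierArg t q z)
        + Tcal S.α (S.interf q) (S.tierArg t q z)) := rfl

/-- The contribution of the serving tier bounds `Ztilde` from below. -/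
lemma transform_le_Ztilde (S : MultiTier T) (t : Fin T) {z : ℝ} (hz : 0 < z) :
    mgfNeg (S.interf t) z + Tcal S.α (S.interf t) z ≤ S.Ztilde t z := by
  have hterm : ∀ q, 0 ≤ (S.κ q / S.F q * (S.F t / S.κ t)) * S.biasRatio t q ^ (2 / S.α) *
      (((S.F q : ℝ) - 1) + mgfNeg (S.interf q) (S.tierArg t q z)
        + Tcal S.α (S.interf q) (S.tierArg t q z)) := by
    intro q
    have h1 := S.κ_pos q
    have h2 := S.κ_pos t
    have h3 := S.biasRatio_pos t q
    have h4 := S.one_le_transform t q hz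
    have h5 := S.one_le_F_cast q
    exact mul_nonneg (by positivity) (by linarith)
  rw [Ztilde_eq]
  refine le_trans ?_ (Finset.single_le_sum (fun q _ => hterm q) (Finset.mem_univ t))
  have h1 := (S.κ_pos t).ne'
  have h2 := (S.F_pos t).ne'
  have h3 : S.biasRatio t t = 1 := by
    have h1 := (S.χ_pos t).ne'
    have h2 := (S.B_pos t).ne'
    simp [biasRatio, h1, h2]
  have h4 := S.one_le_F_cast t
  rw [S.tierArg_self, h3, Real.one_rpow, mul_one,
    show S.κ t / S.F t * (S.F t / S.κ t) = 1 by field_simp]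
  linarith

lemma one_le_Ztilde (S : MultiTier T) (t : Fin T) {z : ℝ} (hz : 0 < z) : 1 ≤ S.Ztilde t z :=
  ((S.interf_law t).one_le_mgfNeg_add_Tcal S.two_lt_α hz).trans (S.transform_le_Ztilde t hz)

/-- Measurability of `excess` comes directly from Tonelli, so it replaces the series; the two agree
for `z > 0`, which is all the integrals see. -/
lemma exists_measurable_eq_Ztilde (S : MultiTier T) (t : Fin T) :
    ∃ f : ℝ → ℝ, Measurable f ∧ ∀ z, 0 < z → S.Ztilde t z = f z := by
  refine ⟨fun z => ∑ q, (S.κ q / S.F q * (S.F t / S.κ t)) * S.biasRatio t q ^ (2 / S.α) *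
      ((S.F q : ℝ) + (excess S.α (S.interf q) (S.tierArg t q z)).toReal), ?_, fun z hz => ?_⟩
  · refine Finset.measurable_sum _ fun q _ => Measurable.const_mul (Measurable.const_add ?_ _) _
    have := (S.interf_law q).isProb
    exact ENNReal.measurable_toReal.comp ((measurable_excess _ _).comp
      (measurable_const.mul measurable_id))
  · rw [Ztilde_eq]
    refine Finset.sum_congr rfl fun q _ => ?_
    rw [(S.interf_law q).excess_eq S.two_lt_α (S.tierArg_pos t q hz), ENNReal.toReal_ofReal
      (by linarith [S.one_le_transform t q hz])]
    ring

variable {S : MultiTier T} {lam : ℝ} {Ω : Type*} [MeasurableSpace Ω] {P : Measure Ω}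
  {D : Deployment T S.F Ω}

/-- Laplace transform of the aggregate interference. -/
lemma IsRealization.laplace_interference [IsProbabilityMeasure P]
    (h : S.IsRealization lam P D) (hlam : 0 < lam) {p : ℝ} (hp : 0 < p) (t : Fin T) {ξ z : ℝ}
    (hξ : 0 < ξ) (hz : 0 < z) :
    ∫⁻ ω, expNeg (ENNReal.ofReal (z * (ξ ^ S.α / (S.χ t * p))) * S.interference p t ξ D ω) ∂P =
      ENNReal.ofReal (Real.exp (Real.pi * ∑ q, S.κ q * lam * S.biasRatio t q ^ (2 / S.α) * ξ ^ 2 -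
        S.bandDensity lam t * S.Ztilde t z * ξ ^ 2)) := by
  -- The transform variable `s = z ξ^α / P_t` makes the received serving power contribute `s P_t g
  -- ξ^(-α) = z g`.
  have hχt := S.χ_pos t
  set s := z * (ξ ^ S.α / (S.χ t * p)) with hs
  have hs0 : 0 ≤ s := by positivity
  set v : Fin T → ℝ := fun q => Real.pi * (S.κ q * lam / S.F q) *
    (S.biasRatio t q ^ (2 / S.α) * ξ ^ 2) * (mgfNeg (S.interf q) (S.tierArg t q z) +
      Tcal S.α (S.interf q) (S.tierArg t q z) - 1) with hv
  have hv0 : ∀ q, 0 ≤ v q := fun q => by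
    have h1 := S.κ_pos q
    have h3 := S.biasRatio_pos t q
    have h4 := S.one_le_transform t q hz
    exact mul_nonneg (by positivity) (by linarith)
  rw [h.lintegral_expNeg_interference]
  have hq : ∀ q, expNeg (ENNReal.ofReal (S.κ q * lam) * ((S.F q : ℝ≥0∞)⁻¹ *
        ∫⁻ x in {x : Plane | S.exclusionRadius t q ξ < ‖x‖},
          ∫⁻ g, (1 - expNeg (ENNReal.ofReal s *
            ENNReal.ofReal (S.χ q * p * g * ‖x‖ ^ (-S.α)))) ∂(S.interf q))) =
      ENNReal.ofReal (Real.exp (-v q)) := by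
    intro q
    have h1 := S.κ_pos q
    have h2 := S.F_pos q
    have h3 := S.biasRatio_pos t q
    have h4 := S.one_le_transform t q hz
    simp_rw [← ENNReal.ofReal_mul hs0]
    simp_rw [show ∀ g x : ℝ, s * (S.χ q * p * g * x) = (s * (S.χ q * p)) * g * x from
      fun g x => by ring]
    rw [lintegral_plane_eq_excess S.two_lt_α (S.exclusionRadius_pos t q hξ)
      (S.tierArg_pos t q hz).le _ (S.interf_law q),
      (S.interf_law q).excess_eq S.two_lt_α (S.tierArg_pos t q hz), ← expNeg_ofReal (hv0 q)]
    · congr 1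
      rw [← ENNReal.ofReal_natCast, ← ENNReal.ofReal_inv_of_pos h2,
        ← ENNReal.ofReal_mul (by positivity), ← ENNReal.ofReal_mul (by positivity),
        ← ENNReal.ofReal_mul (by positivity), S.exclusionRadius_sq, hv]
      congr 1
      ring
    -- Since the exclusion radius scales with `ξ`, the product `s P_q` is `tierArg` times the `α`-th
    -- power of that radius, and `ξ` disappears from the argument of the transforms.
    · rw [S.exclusionRadius_rpow t q hξ, hs, tierArg]
      field_simp
  simp_rw [hq]
  rw [← ENNReal.ofReal_prod_of_nonneg fun q _ => Real.exp_nonneg _, ← Real.exp_sum]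
  congr 2
  -- Split `(F_q - 1) + M_q + T_q = F_q + (M_q + T_q - 1)`: the parts `F_q` add up to the
  -- association exponent, and the rest is `∑ v q`.
  rw [Ztilde_eq, bandDensity, Finset.mul_sum, Finset.mul_sum, Finset.sum_mul,
    ← Finset.sum_sub_distrib]
  refine Finset.sum_congr rfl fun q _ => ?_
  have h1 := (S.κ_pos t).ne'
  have h2 := (S.F_pos t).ne'
  have h3 := (S.F_pos q).ne'
  rw [hv]
  field_simp
  ring

/-- Almost surely some BS interferes. -/
lemma IsRealization.ae_interference_ne_zero [IsProbabilityMeasure P]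
    (h : S.IsRealization lam P D) (hlam : 0 < lam) {p : ℝ} (hp : 0 < p) (t : Fin T) {ξ : ℝ}
    (hξ : 0 < ξ) : ∀ᵐ ω ∂P, S.interference p t ξ D ω ≠ 0 := by
  -- The probability of zero interference is at most its Laplace transform at every `z`, which tends
  -- to `0` by the growth of `Ztilde`. Without this, at zero noise, the infinite SINR would get the
  -- default value `0` under `toReal`.
  obtain ⟨c, hc, hcz⟩ := (S.interf_law t).exists_le_mgfNeg_add_Tcal S.two_lt_α
  set C := Real.pi * ∑ q, S.κ q * lam * S.biasRatio t q ^ (2 / S.α) * ξ ^ 2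
  have hA := S.bandDensity_pos hlam t
  have hmeas : MeasurableSet {ω | S.interference p t ξ D ω = 0} :=
    h.measurable_interference p t ξ (measurableSet_singleton 0)
  have hle : ∀ z : ℝ, 0 < z → P {ω | S.interference p t ξ D ω = 0} ≤
      ENNReal.ofReal (Real.exp (C - S.bandDensity lam t * (c * z ^ (2 / S.α)) * ξ ^ 2)) := by
    intro z hz
    calc P {ω | S.interference p t ξ D ω = 0}
        = ∫⁻ ω in {ω | S.interference p t ξ D ω = 0}, 1 ∂P := by simp
      _ = ∫⁻ ω in {ω | S.interference p t ξ D ω = 0},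
          expNeg (ENNReal.ofReal (z * (ξ ^ S.α / (S.χ t * p))) * S.interference p t ξ D ω) ∂P := by
          refine setLIntegral_congr_fun hmeas fun ω hω => ?_
          have hω : S.interference p t ξ D ω = 0 := hω
          simp [hω]
      _ ≤ _ := setLIntegral_le_lintegral _ _
      _ = _ := h.laplace_interference hlam hp t hξ hz
      _ ≤ _ := by
          refine ENNReal.ofReal_le_ofReal (Real.exp_le_exp.2 (sub_le_sub_left ?_ _))
          have := (hcz z hz).trans (S.transform_le_Ztilde t hz)
          gcongr
  have hlim : Tendsto (fun z : ℝ => ENNReal.ofReal (Real.exp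
      (C - S.bandDensity lam t * (c * z ^ (2 / S.α)) * ξ ^ 2))) atTop (𝓝 0) := by
    rw [← ENNReal.ofReal_zero]
    refine (ENNReal.continuous_ofReal.tendsto 0).comp (Real.tendsto_exp_atBot.comp ?_)
    have h1 : Tendsto (fun z : ℝ => S.bandDensity lam t * c * ξ ^ 2 * z ^ (2 / S.α)) atTop atTop :=
      (tendsto_rpow_atTop (div_pos two_pos S.α_pos)).const_mul_atTop (by positivity)
    refine (tendsto_atBot_add_const_left _ C (tendsto_neg_atTop_atBot.comp h1)).congr fun z => ?_
    simp only [Function.comp_apply]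
    ring
  have h0 : P {ω | S.interference p t ξ D ω = 0} = 0 := by
    refine nonpos_iff_eq_zero.1 (ge_of_tendsto hlim ?_)
    filter_upwards [eventually_gt_atTop 0] with z hz using hle z hz
  rw [ae_iff]
  simpa using h0

/-- Rate conditioned on service at distance `ξ`. -/
lemma IsRealization.condRate_eq [IsProbabilityMeasure P]
    (h : S.IsRealization lam P D) (hlam : 0 < lam) {p : ℝ} (hp : 0 < p) {σ2 : ℝ} (hσ : 0 ≤ σ2)
    (t : Fin T) {ξ : ℝ} (hξ : 0 < ξ) :
    S.condRate p σ2 t ξ P D = (S.F t : ℝ≥0∞)⁻¹ * ∫⁻ z in Ioi (0 : ℝ),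
      ENNReal.ofReal ((1 - mgfNeg (S.serving t) z) / z) *
        ENNReal.ofReal (Real.exp (-(z * (ξ ^ S.α / (S.χ t * p)) * σ2) +
          (Real.pi * ∑ q, S.κ q * lam * S.biasRatio t q ^ (2 / S.α) * ξ ^ 2 -
            S.bandDensity lam t * S.Ztilde t z * ξ ^ 2))) := by
  have hχt := S.χ_pos t
  set k := ξ ^ S.α / (S.χ t * p) with hk
  have hk0 : 0 < k := by positivity
  have hg0 : ∀ᵐ ω ∂P, 0 ≤ D.g₀ t ω := by
    have := (S.serving_law t).nonneg
    rw [← h.serving_gain_law t] at this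
    exact ae_of_ae_map (h.measurable_serving t).aemeasurable this
  rw [condRate]
  congr 1
  set I := S.interference p t ξ D
  have hI : Measurable I := h.measurable_interference p t ξ
  have hg : Measurable (D.g₀ t) := h.measurable_serving t
  have h1 : ∀ᵐ ω ∂P, ENNReal.ofReal (Real.log (1 + (S.sinr p σ2 t ξ D ω).toReal)) =
      ∫⁻ z in Ioi (0 : ℝ), ENNReal.ofReal ((1 - Real.exp (-(z * D.g₀ t ω))) / z) *
        (ENNReal.ofReal (Real.exp (-(z * k * σ2))) * expNeg (ENNReal.ofReal (z * k) * I ω)) := by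
    filter_upwards [hg0, h.ae_interference_ne_zero hlam hp t hξ] with ω hω hIω
    -- Multiplying numerator and denominator by `k = ξ^α / P_t` leaves the bare gain in the
    -- numerator.
    have hsinr : S.sinr p σ2 t ξ D ω = ENNReal.ofReal (D.g₀ t ω) /
        (ENNReal.ofReal k * (ENNReal.ofReal σ2 + I ω)) := by
      rw [sinr, ← ENNReal.mul_div_mul_left _ _ (c := ENNReal.ofReal k) (by simpa using hk0)
        ENNReal.ofReal_ne_top, ← ENNReal.ofReal_mul hk0.le]
      congr 2
      rw [hk, Real.rpow_neg hξ.le]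
      field_simp
    rw [hsinr, ofReal_log_one_add_div hω (by
      simp only [ne_eq, mul_eq_zero, add_eq_zero, not_or, not_and]
      exact ⟨by simpa using hk0, fun _ => hIω⟩)]
    refine setLIntegral_congr_fun measurableSet_Ioi fun z hz => ?_
    have hz : 0 < z := hz
    rw [← mul_assoc, ← ENNReal.ofReal_mul hz.le, mul_add, expNeg_add,
      ← ENNReal.ofReal_mul (by positivity), expNeg_ofReal (by positivity)]
  rw [lintegral_congr_ae h1, lintegral_lintegral_swap]
  · refine setLIntegral_congr_fun measurableSet_Ioi fun z hz => ?_
    have hz : 0 < z := hz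
    have hm : Measurable fun x : ℝ≥0∞ => ENNReal.ofReal (Real.exp (-(z * k * σ2))) *
        expNeg (ENNReal.ofReal (z * k) * x) :=
      (measurable_expNeg.comp (measurable_const.mul measurable_id)).const_mul _
    have hm' : Measurable fun g : ℝ => ENNReal.ofReal ((1 - Real.exp (-(z * g))) / z) := by
      fun_prop
    rw [lintegral_mul_eq_lintegral_mul_lintegral_of_indepFun''
      (f := fun ω => ENNReal.ofReal ((1 - Real.exp (-(z * D.g₀ t ω))) / z))
      (g := fun ω => ENNReal.ofReal (Real.exp (-(z * k * σ2))) *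
        expNeg (ENNReal.ofReal (z * k) * I ω)) (hm'.comp hg).aemeasurable
      (hm.comp hI).aemeasurable ((h.indepFun_interference p t ξ).comp hm' hm),
      lintegral_const_mul' _ _ ENNReal.ofReal_ne_top, h.laplace_interference hlam hp t hξ hz,
      Real.exp_add, ENNReal.ofReal_mul (Real.exp_nonneg _),
      ← lintegral_map (f := fun g : ℝ => ENNReal.ofReal ((1 - Real.exp (-(z * g))) / z)) hm' hg,
      h.serving_gain_law t]
    congr 1
    simp_rw [div_eq_mul_inv, ENNReal.ofReal_mul' (inv_nonneg.2 hz.le)]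
    rw [lintegral_mul_const' _ _ ENNReal.ofReal_ne_top,
      (S.serving_law t).lintegral_one_sub_exp_neg hz.le]
  · refine Measurable.aemeasurable ?_
    refine Measurable.mul (by fun_prop) (Measurable.mul (by fun_prop) (measurable_expNeg.comp ?_))
    exact Measurable.mul (by fun_prop) (hI.comp measurable_fst)

/-- The substitution `u = A ξ²` removes the density `A` from the interference exponent and leaves it
only in the coefficient of the noise term, as `A^(-α/2)`. -/
lemma lintegral_rate_substitution {A Z c α : ℝ} (hA : 0 < A) :
    ∫⁻ ξ in Ioi (0 : ℝ), ENNReal.ofReal (2 * A * ξ *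
        Real.exp (-(c * ξ ^ α) - A * Z * ξ ^ 2)) =
      ∫⁻ u in Ioi (0 : ℝ), ENNReal.ofReal (Real.exp (-(c * A ^ (-(α / 2)) * u ^ (α / 2)) - Z * u)) := by
  have himg : (fun ξ : ℝ => A * ξ ^ 2) '' Ioi 0 = Ioi 0 := by
    ext u
    simp only [mem_image, mem_Ioi]
    constructor
    · rintro ⟨ξ, hξ, rfl⟩
      positivity
    · intro hu
      refine ⟨Real.sqrt (u / A), Real.sqrt_pos.2 (by positivity), ?_⟩
      rw [Real.sq_sqrt (by positivity)]
      field_simp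
  have hinj : InjOn (fun ξ : ℝ => A * ξ ^ 2) (Ioi 0) := by
    intro x hx y hy hxy
    have hx : 0 < x := hx
    have hy : 0 < y := hy
    have : x ^ 2 = y ^ 2 := mul_left_cancel₀ hA.ne' hxy
    exact (pow_left_inj₀ hx.le hy.le two_ne_zero).1 this
  have hder : ∀ ξ ∈ Ioi (0 : ℝ), HasDerivWithinAt (fun ξ : ℝ => A * ξ ^ 2) (2 * A * ξ) (Ioi 0) ξ := by
    intro ξ _
    refine (((hasDerivAt_pow 2 ξ).const_mul A).congr_deriv ?_).hasDerivWithinAt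
    simp
    ring
  have key := lintegral_image_eq_lintegral_abs_deriv_mul measurableSet_Ioi hder hinj
    (fun u => ENNReal.ofReal (Real.exp (-(c * A ^ (-(α / 2)) * u ^ (α / 2)) - Z * u)))
  rw [himg] at key
  rw [key]
  refine setLIntegral_congr_fun measurableSet_Ioi fun ξ hξ => ?_
  have hξ : 0 < ξ := hξ
  rw [abs_of_pos (by positivity), ← ENNReal.ofReal_mul (by positivity)]
  congr 3
  have h1 : (A * ξ ^ 2) ^ (α / 2) = A ^ (α / 2) * ξ ^ α := by
    rw [Real.mul_rpow hA.le (by positivity), ← Real.rpow_natCast ξ 2, ← Real.rpow_mul hξ.le]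
    congr 2
    push_cast
    ring
  have h2 : A ^ (-(α / 2)) * A ^ (α / 2) = 1 := by
    rw [← Real.rpow_add hA]
    simp
  rw [h1]
  linear_combination c * ξ ^ α * h2

end MultiTier

/-! ### Integrals damped by a small exponential -/

section ExponentialDamping

variable {E : Type*} [MeasurableSpace E] {μ : Measure E} {h x : E → ℝ}

lemma integrable_mul_exp_neg (hh : Integrable h μ) (hx : AEStronglyMeasurable x μ)
    (hx0 : ∀ᵐ e ∂μ, 0 ≤ x e) {s : ℝ} (hs : 0 ≤ s) :
    Integrable (fun e => h e * Real.exp (-(s * x e))) μ := by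
  refine hh.mono (hh.1.mul (Real.continuous_exp.comp_aestronglyMeasurable (hx.const_mul s).neg)) ?_
  filter_upwards [hx0] with e he
  rw [norm_mul, Real.norm_of_nonneg (Real.exp_nonneg _)]
  exact mul_le_of_le_one_right (norm_nonneg _) (Real.exp_le_one_iff.2 (by
    simp only [Left.neg_nonpos_iff]
    positivity))

lemma integral_mul_exp_neg_le (hh : Integrable h μ) (hh0 : ∀ᵐ e ∂μ, 0 ≤ h e)
    (hx : AEStronglyMeasurable x μ) (hx0 : ∀ᵐ e ∂μ, 0 ≤ x e) {s : ℝ} (hs : 0 ≤ s) :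
    ∫ e, h e * Real.exp (-(s * x e)) ∂μ ≤ ∫ e, h e ∂μ := by
  refine integral_mono_ae (integrable_mul_exp_neg hh hx hx0 hs) hh ?_
  filter_upwards [hh0, hx0] with e he hxe
  exact mul_le_of_le_one_right he (Real.exp_le_one_iff.2 (by
    simp only [Left.neg_nonpos_iff]
    positivity))

/-- Integrated form of `exp (-s x) ≥ 1 - s x`. -/
lemma le_integral_mul_exp_neg (hh : Integrable h μ) (hh0 : ∀ᵐ e ∂μ, 0 ≤ h e)
    (hx : AEStronglyMeasurable x μ) (hx0 : ∀ᵐ e ∂μ, 0 ≤ x e)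
    (hhx : Integrable (fun e => h e * x e) μ) {s : ℝ} (hs : 0 ≤ s) :
    ∫ e, h e ∂μ - s * ∫ e, h e * x e ∂μ ≤ ∫ e, h e * Real.exp (-(s * x e)) ∂μ := by
  rw [← integral_const_mul, ← integral_sub hh (hhx.const_mul s)]
  refine integral_mono_ae (hh.sub (hhx.const_mul s)) (integrable_mul_exp_neg hh hx hx0 hs) ?_
  filter_upwards [hh0] with e he
  have := Real.add_one_le_exp (-(s * x e))
  nlinarith

/-- Dominated convergence with bound `‖h‖`. The filter contains `s = 0`, as the dense-network limit
includes the noiseless case. -/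
lemma tendsto_integral_mul_exp_neg (hh : Integrable h μ)
    (hx : AEStronglyMeasurable x μ) (hx0 : ∀ᵐ e ∂μ, 0 ≤ x e) :
    Tendsto (fun s : ℝ => ∫ e, h e * Real.exp (-(s * x e)) ∂μ) (𝓝[≥] 0) (𝓝 (∫ e, h e ∂μ)) := by
  refine tendsto_integral_filter_of_dominated_convergence (fun e => ‖h e‖) ?_ ?_ hh.norm ?_
  · filter_upwards [self_mem_nhdsWithin] with s hs
    exact (integrable_mul_exp_neg hh hx hx0 hs).1
  · filter_upwards [self_mem_nhdsWithin] with s hs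
    have hs : 0 ≤ s := hs
    filter_upwards [hx0] with e he
    rw [norm_mul, Real.norm_of_nonneg (Real.exp_nonneg _)]
    exact mul_le_of_le_one_right (norm_nonneg _) (Real.exp_le_one_iff.2 (by
      simp only [Left.neg_nonpos_iff]
      positivity))
  · refine .of_forall fun e => ?_
    have : Continuous fun s : ℝ => h e * Real.exp (-(s * x e)) := by fun_prop
    have := (this.tendsto 0).mono_left (nhdsWithin_le_nhds (s := Ici 0))
    simpa using this

/-- First-order expansion of `s ↦ ∫ h exp (-s x)` at zero. -/
lemma tendsto_integral_mul_exp_neg_sub_div (hh : Integrable h μ) (hx : AEStronglyMeasurable x μ)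
    (hx0 : ∀ᵐ e ∂μ, 0 ≤ x e) (hhx : Integrable (fun e => h e * x e) μ) :
    Tendsto (fun s : ℝ => (∫ e, h e * Real.exp (-(s * x e)) ∂μ -
      (∫ e, h e ∂μ - s * ∫ e, h e * x e ∂μ)) / s) (𝓝[>] 0) (𝓝 0) := by
  -- With `w = s x ≥ 0` one has `0 ≤ exp (-w) - 1 + w ≤ w`, so the quotient is dominated by `‖h x‖`;
  -- pointwise it is the slope at `0` of a function with zero derivative there.
  have key : Tendsto (fun s : ℝ => ∫ e, (h e * Real.exp (-(s * x e)) - (h e - s * (h e * x e))) / s ∂μ)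
      (𝓝[>] 0) (𝓝 (∫ _, (0 : ℝ) ∂μ)) := by
    refine tendsto_integral_filter_of_dominated_convergence (fun e => ‖h e * x e‖) ?_ ?_
      hhx.norm ?_
    · filter_upwards [self_mem_nhdsWithin] with s hs
      have hs : 0 < s := hs
      exact (((integrable_mul_exp_neg hh hx hx0 hs.le).sub (hh.sub (hhx.const_mul s))).div_const s).1
    · filter_upwards [self_mem_nhdsWithin] with s hs
      have hs : 0 < s := hs
      filter_upwards [hx0] with e he
      have h1 := Real.add_one_le_exp (-(s * x e))
      have h2 : Real.exp (-(s * x e)) ≤ 1 := Real.exp_le_one_iff.2 (by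
        simp only [Left.neg_nonpos_iff]
        positivity)
      have h3 : (h e * Real.exp (-(s * x e)) - (h e - s * (h e * x e))) / s =
          h e * ((Real.exp (-(s * x e)) - 1 + s * x e) / s) := by ring
      rw [h3, norm_mul, norm_mul, Real.norm_of_nonneg he,
        Real.norm_of_nonneg (div_nonneg (by linarith) hs.le)]
      refine mul_le_mul_of_nonneg_left ?_ (norm_nonneg _)
      rw [div_le_iff₀ hs]
      linarith
    · refine .of_forall fun e => ?_
      have hd : HasDerivAt (fun s : ℝ => h e * Real.exp (-(s * x e)) - (h e - s * (h e * x e))) 0 0 := by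
        have h1 : HasDerivAt (fun s : ℝ => -(s * x e)) (-(1 * x e)) 0 :=
          ((hasDerivAt_id (0 : ℝ)).mul_const (x e)).neg
        have h2 : HasDerivAt (fun s : ℝ => h e - s * (h e * x e)) (-(1 * (h e * x e))) 0 :=
          ((hasDerivAt_id (0 : ℝ)).mul_const (h e * x e)).const_sub (h e)
        refine ((h1.exp.const_mul (h e)).sub h2).congr_deriv ?_
        simp
      have := (hasDerivAt_iff_tendsto_slope_zero.1 hd).mono_left
        (nhdsWithin_mono 0 (fun s hs => ne_of_gt hs : Ioi (0 : ℝ) ⊆ {0}ᶜ))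
      refine this.congr fun s => ?_
      simp only [zero_add, smul_eq_mul]
      simp
      ring
  rw [integral_zero] at key
  refine key.congr' ?_
  filter_upwards [self_mem_nhdsWithin] with s hs
  have hs : 0 < s := hs
  rw [integral_div, integral_sub (g := fun e => h e - s * (h e * x e))
    (integrable_mul_exp_neg hh hx hx0 hs.le) (hh.sub (hhx.const_mul s)), integral_sub hh (hhx.const_mul s), integral_const_mul]

end ExponentialDamping

/-! ### The rate as a damped integral over the quadrant -/

namespace MultiTier

variable {T : ℕ}

/-- The integrand of the average rate at zero noise, in the transform variable `z` and the
normalized squared distance `u`. -/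
def rateKernel (S : MultiTier T) (t : Fin T) (e : ℝ × ℝ) : ℝ :=
  (1 - mgfNeg (S.serving t) e.1) / e.1 * Real.exp (-(S.Ztilde t e.1 * e.2))

/-- The exponent through which the noise enters the average rate. -/
def noiseExponent (S : MultiTier T) (e : ℝ × ℝ) : ℝ := e.1 * e.2 ^ (S.α / 2)

/-- The measure on the quadrant `(0, ∞)²`. -/
def quadrant : Measure (ℝ × ℝ) := (volume.restrict (Ioi 0)).prod (volume.restrict (Ioi 0))

/-- The normalized noise power. -/
def noiseLevel (S : MultiTier T) (lam p σ2 : ℝ) (t : Fin T) : ℝ :=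
  σ2 / (S.χ t * p) * S.bandDensity lam t ^ (-(S.α / 2))

lemma ae_quadrant : ∀ᵐ e ∂quadrant, 0 < e.1 ∧ 0 < e.2 := by
  rw [quadrant, Measure.prod_restrict]
  filter_upwards [ae_restrict_mem (measurableSet_Ioi.prod measurableSet_Ioi)] with e he
  exact he

lemma rateKernel_nonneg (S : MultiTier T) (t : Fin T) : ∀ᵐ e ∂quadrant, 0 ≤ S.rateKernel t e := by
  filter_upwards [ae_quadrant] with e he
  have := (S.serving_law t).mgfNeg_le_one he.1.le
  exact mul_nonneg (div_nonneg (by linarith) he.1.le) (Real.exp_nonneg _)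

lemma noiseExponent_nonneg (S : MultiTier T) : ∀ᵐ e ∂quadrant, 0 ≤ S.noiseExponent e := by
  filter_upwards [ae_quadrant] with e he
  exact mul_nonneg he.1.le (Real.rpow_nonneg he.2.le _)

lemma measurable_noiseExponent (S : MultiTier T) : Measurable S.noiseExponent := by
  unfold noiseExponent
  fun_prop

lemma aemeasurable_rateKernel (S : MultiTier T) (t : Fin T) :
    AEMeasurable (S.rateKernel t) quadrant := by
  obtain ⟨f, hf, hfZ⟩ := S.exists_measurable_eq_Ztilde t
  have := (S.serving_law t).isProb
  have hM := measurable_mgfNeg (S.serving t)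
  refine ⟨fun e => (1 - mgfNeg (S.serving t) e.1) / e.1 * Real.exp (-(f e.1 * e.2)), ?_, ?_⟩
  · exact ((measurable_const.sub (hM.comp measurable_fst)).div measurable_fst).mul
      (((hf.comp measurable_fst).mul measurable_snd).neg.exp)
  · filter_upwards [ae_quadrant] with e he
    simp only [rateKernel, hfZ _ he.1]

lemma aestronglyMeasurable_limitIntegrand (S : MultiTier T) (t : Fin T) :
    AEStronglyMeasurable (S.limitIntegrand t) (volume.restrict (Ioi 0)) := by
  obtain ⟨f, hf, hfZ⟩ := S.exists_measurable_eq_Ztilde t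
  have := (S.serving_law t).isProb
  have hM := measurable_mgfNeg (S.serving t)
  refine AEStronglyMeasurable.congr (f := fun z => (1 - mgfNeg (S.serving t) z) / f z * (1 / z)) ?_ ?_
  · exact (((measurable_const.sub hM).div hf).mul
      (measurable_const.div measurable_id)).aestronglyMeasurable
  · filter_upwards [ae_restrict_mem measurableSet_Ioi] with z hz
    simp only [limitIntegrand, hfZ z hz]

lemma aestronglyMeasurable_correctionIntegrand (S : MultiTier T) (t : Fin T) :
    AEStronglyMeasurable (S.correctionIntegrand t) (volume.restrict (Ioi 0)) := by
  obtain ⟨f, hf, hfZ⟩ := S.exists_measurable_eq_Ztilde t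
  have := (S.serving_law t).isProb
  have hM := measurable_mgfNeg (S.serving t)
  refine AEStronglyMeasurable.congr
    (f := fun z => (1 - mgfNeg (S.serving t) z) / (f z) ^ (1 + S.α / 2)) ?_ ?_
  · exact ((measurable_const.sub hM).div (hf.pow_const _)).aestronglyMeasurable
  · filter_upwards [ae_restrict_mem measurableSet_Ioi] with z hz
    simp only [correctionIntegrand, hfZ z hz]

lemma integrableOn_Ioi_of_bounds {f : ℝ → ℝ} {K b : ℝ} (hb : b < -1)
    (hf : AEStronglyMeasurable f (volume.restrict (Ioi 0)))
    (h1 : ∀ z ∈ Ioc (0 : ℝ) 1, ‖f z‖ ≤ 1) (h2 : ∀ z ∈ Ioi (1 : ℝ), ‖f z‖ ≤ K * z ^ b) :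
    IntegrableOn f (Ioi 0) := by
  rw [← Ioc_union_Ioi_eq_Ioi zero_le_one]
  refine IntegrableOn.union ?_ ?_
  · refine Integrable.of_bound (hf.mono_set Ioc_subset_Ioi_self) 1 ?_
    filter_upwards [ae_restrict_mem measurableSet_Ioc] with z hz using h1 z hz
  · refine Integrable.mono' ((integrableOn_Ioi_rpow_of_lt hb one_pos).const_mul K)
      (hf.mono_set (Ioi_subset_Ioi zero_le_one)) ?_
    filter_upwards [ae_restrict_mem measurableSet_Ioi] with z hz using h2 z hz

/-- Near `0` the integrand is at most `1`, by `Ztilde ≥ 1` and `1 - M(z) ≤ z`; beyond `1` the growth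
of `Ztilde` gives decay `z^(-1 - 2/α)`. -/
lemma integrableOn_limitIntegrand (S : MultiTier T) (t : Fin T) :
    IntegrableOn (S.limitIntegrand t) (Ioi 0) := by
  obtain ⟨c, hc, hcz⟩ := (S.interf_law t).exists_le_mgfNeg_add_Tcal S.two_lt_α
  have hα := div_pos two_pos S.α_pos
  refine integrableOn_Ioi_of_bounds (K := c⁻¹) (b := -(2 / S.α) - 1) (by linarith)
    (S.aestronglyMeasurable_limitIntegrand t) (fun z hz => ?_) (fun z hz => ?_)
  · have hz0 := hz.1
    have hZ := S.one_le_Ztilde t hz0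
    have hM1 := (S.serving_law t).mgfNeg_le_one hz0.le
    have hM2 := (S.serving_law t).one_sub_mgfNeg_le hz0.le
    rw [limitIntegrand, Real.norm_of_nonneg (mul_nonneg (div_nonneg (by linarith) (by linarith))
      (by positivity)), mul_one_div, div_le_one hz0]
    exact (div_le_self (by linarith) hZ).trans hM2
  · have hz1 : 1 < z := hz
    have hz0 : 0 < z := by linarith
    have hZ := (hcz z hz0).trans (S.transform_le_Ztilde t hz0)
    have hZ0 := S.one_le_Ztilde t hz0
    have hM0 := mgfNeg_nonneg (S.serving t) z
    have hM1 := (S.serving_law t).mgfNeg_le_one hz0.le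
    rw [limitIntegrand, Real.norm_of_nonneg (mul_nonneg (div_nonneg (by linarith) (by linarith))
      (by positivity)), Real.rpow_sub hz0, Real.rpow_neg hz0.le, Real.rpow_one, ← mul_one_div (_⁻¹) z,
      ← mul_assoc, ← mul_inv, ← one_div]
    gcongr
    linarith

/-- The decay is again `z^(-1 - 2/α)`, because `(2/α)(1 + α/2) = 2/α + 1`. -/
lemma integrableOn_correctionIntegrand (S : MultiTier T) (t : Fin T) :
    IntegrableOn (S.correctionIntegrand t) (Ioi 0) := by
  obtain ⟨c, hc, hcz⟩ := (S.interf_law t).exists_le_mgfNeg_add_Tcal S.two_lt_α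
  have hα := div_pos two_pos S.α_pos
  have hα0 := S.α_pos
  refine integrableOn_Ioi_of_bounds (K := (c ^ (1 + S.α / 2))⁻¹) (b := -(2 / S.α) - 1) (by linarith)
    (S.aestronglyMeasurable_correctionIntegrand t) (fun z hz => ?_) (fun z hz => ?_)
  · have hz0 := hz.1
    have hZ := S.one_le_Ztilde t hz0
    have hM0 := mgfNeg_nonneg (S.serving t) z
    have hM1 := (S.serving_law t).mgfNeg_le_one hz0.le
    rw [correctionIntegrand, Real.norm_of_nonneg (div_nonneg (by linarith) (by positivity))]
    refine (div_le_self (by linarith) (Real.one_le_rpow hZ (by positivity))).trans (by linarith)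
  · have hz1 : 1 < z := hz
    have hz0 : 0 < z := by linarith
    have hZ := (hcz z hz0).trans (S.transform_le_Ztilde t hz0)
    have hZ0 := S.one_le_Ztilde t hz0
    have hM0 := mgfNeg_nonneg (S.serving t) z
    have hM1 := (S.serving_law t).mgfNeg_le_one hz0.le
    have hpow : (c * z ^ (2 / S.α)) ^ (1 + S.α / 2) ≤ S.Ztilde t z ^ (1 + S.α / 2) :=
      Real.rpow_le_rpow (by positivity) hZ (by positivity)
    have he : (c * z ^ (2 / S.α)) ^ (1 + S.α / 2) = c ^ (1 + S.α / 2) * z ^ (2 / S.α + 1) := by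
      rw [Real.mul_rpow hc.le (by positivity), ← Real.rpow_mul hz0.le]
      congr 2
      field_simp
    rw [correctionIntegrand, Real.norm_of_nonneg (div_nonneg (by linarith) (by positivity)),
      show -(2 / S.α) - 1 = -(2 / S.α + 1) by ring, Real.rpow_neg hz0.le, ← mul_inv, ← he, ← one_div]
    gcongr
    linarith

/-- The rate kernel integrates to the limiting rate. -/
lemma lintegral_rateKernel (S : MultiTier T) (t : Fin T) :
    ∫⁻ e, ENNReal.ofReal (S.rateKernel t e) ∂quadrant =
      ∫⁻ z in Ioi (0 : ℝ), ENNReal.ofReal (S.limitIntegrand t z) := by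
  rw [quadrant, lintegral_prod _ (S.aemeasurable_rateKernel t).ennreal_ofReal]
  refine setLIntegral_congr_fun measurableSet_Ioi fun z hz => ?_
  have hz : 0 < z := hz
  have hZ := S.one_le_Ztilde t hz
  have hM1 := (S.serving_law t).mgfNeg_le_one hz.le
  have h0 : 0 ≤ (1 - mgfNeg (S.serving t) z) / z := div_nonneg (by linarith) hz.le
  simp only [rateKernel, ENNReal.ofReal_mul h0]
  rw [lintegral_const_mul' _ _ ENNReal.ofReal_ne_top, lintegral_exp_neg_mul_Ioi (by linarith),
    ← ENNReal.ofReal_mul h0, limitIntegrand]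
  congr 1
  ring

/-- The factor `z` of the noise exponent cancels `1 / z`, and the `u`-integral of `u^(α/2) exp (-Z
u)` is `Γ(1 + α/2) Z^(-1 - α/2)`. -/
lemma lintegral_rateKernel_mul_noiseExponent (S : MultiTier T) (t : Fin T) :
    ∫⁻ e, ENNReal.ofReal (S.rateKernel t e * S.noiseExponent e) ∂quadrant =
      ∫⁻ z in Ioi (0 : ℝ), ENNReal.ofReal (Real.Gamma (1 + S.α / 2) * S.correctionIntegrand t z) := by
  have hα := S.α_pos
  rw [quadrant, lintegral_prod (fun e => ENNReal.ofReal (S.rateKernel t e * S.noiseExponent e))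
    ((S.aemeasurable_rateKernel t).mul S.measurable_noiseExponent.aemeasurable).ennreal_ofReal]
  refine setLIntegral_congr_fun measurableSet_Ioi fun z hz => ?_
  have hz : 0 < z := hz
  have hZ := S.one_le_Ztilde t hz
  have hZ0 : 0 < S.Ztilde t z := by linarith
  have hM1 := (S.serving_law t).mgfNeg_le_one hz.le
  have h0 : 0 ≤ 1 - mgfNeg (S.serving t) z := by linarith
  have h1 : ∀ u : ℝ, S.rateKernel t (z, u) * S.noiseExponent (z, u) =
      (1 - mgfNeg (S.serving t) z) * (u ^ (S.α / 2 + 1 - 1) * Real.exp (-(S.Ztilde t z * u))) := by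
    intro u
    simp only [rateKernel, noiseExponent, add_sub_cancel_right]
    field_simp
  have hi : IntegrableOn (fun u : ℝ => u ^ (S.α / 2 + 1 - 1) * Real.exp (-(S.Ztilde t z * u)))
      (Ioi 0) := by
    have := integrableOn_rpow_mul_exp_neg_mul_rpow (p := 1) (s := S.α / 2 + 1 - 1) (by linarith)
      one_pos hZ0
    simpa using this
  simp only [h1, ENNReal.ofReal_mul h0]
  rw [lintegral_const_mul' _ _ ENNReal.ofReal_ne_top, ← ofReal_integral_eq_lintegral_ofReal hi,
    Real.integral_rpow_mul_exp_neg_mul_Ioi (by positivity) hZ0, ← ENNReal.ofReal_mul h0,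
    correctionIntegrand]
  · congr 1
    rw [one_div, Real.inv_rpow hZ0.le, add_comm (S.α / 2) 1]
    ring
  · filter_upwards [ae_restrict_mem measurableSet_Ioi] with u hu
    have hu : 0 < u := hu
    simp only [Pi.zero_apply]
    positivity

lemma limitIntegrand_nonneg (S : MultiTier T) (t : Fin T) :
    ∀ᵐ z ∂volume.restrict (Ioi (0 : ℝ)), 0 ≤ S.limitIntegrand t z := by
  filter_upwards [ae_restrict_mem measurableSet_Ioi] with z hz
  have hz : 0 < z := hz
  have hZ := S.one_le_Ztilde t hz
  have hM1 := (S.serving_law t).mgfNeg_le_one hz.le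
  exact mul_nonneg (div_nonneg (by linarith) (by linarith)) (by positivity)

lemma correctionIntegrand_nonneg (S : MultiTier T) (t : Fin T) :
    ∀ᵐ z ∂volume.restrict (Ioi (0 : ℝ)), 0 ≤ S.correctionIntegrand t z := by
  filter_upwards [ae_restrict_mem measurableSet_Ioi] with z hz
  have hz : 0 < z := hz
  have hZ := S.one_le_Ztilde t hz
  have hM1 := (S.serving_law t).mgfNeg_le_one hz.le
  exact div_nonneg (by linarith) (Real.rpow_nonneg (by linarith) _)

lemma integrable_rateKernel (S : MultiTier T) (t : Fin T) :
    Integrable (S.rateKernel t) quadrant := by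
  refine ⟨(S.aemeasurable_rateKernel t).aestronglyMeasurable, ?_⟩
  rw [hasFiniteIntegral_iff_ofReal (S.rateKernel_nonneg t), S.lintegral_rateKernel]
  exact (S.integrableOn_limitIntegrand t).lintegral_lt_top

lemma integral_rateKernel (S : MultiTier T) (t : Fin T) :
    ∫ e, S.rateKernel t e ∂quadrant = S.limitRate t := by
  rw [integral_eq_lintegral_of_nonneg_ae (S.rateKernel_nonneg t) (S.integrable_rateKernel t).1,
    S.lintegral_rateKernel, limitRate, integral_eq_lintegral_of_nonneg_ae
    (S.limitIntegrand_nonneg t) (S.aestronglyMeasurable_limitIntegrand t)]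

lemma rateKernel_mul_noiseExponent_nonneg (S : MultiTier T) (t : Fin T) :
    ∀ᵐ e ∂quadrant, 0 ≤ S.rateKernel t e * S.noiseExponent e := by
  filter_upwards [S.rateKernel_nonneg t, S.noiseExponent_nonneg] with e h1 h2 using mul_nonneg h1 h2

lemma integrable_rateKernel_mul_noiseExponent (S : MultiTier T) (t : Fin T) :
    Integrable (fun e => S.rateKernel t e * S.noiseExponent e) quadrant := by
  refine ⟨((S.aemeasurable_rateKernel t).mul
    S.measurable_noiseExponent.aemeasurable).aestronglyMeasurable, ?_⟩
  rw [hasFiniteIntegral_iff_ofReal (S.rateKernel_mul_noiseExponent_nonneg t),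
    S.lintegral_rateKernel_mul_noiseExponent]
  exact ((S.integrableOn_correctionIntegrand t).const_mul _).lintegral_lt_top

lemma integral_rateKernel_mul_noiseExponent (S : MultiTier T) (t : Fin T) :
    ∫ e, S.rateKernel t e * S.noiseExponent e ∂quadrant =
      Real.Gamma (1 + S.α / 2) * ∫ z in Ioi (0 : ℝ), S.correctionIntegrand t z := by
  have hα := S.α_pos
  rw [integral_eq_lintegral_of_nonneg_ae (S.rateKernel_mul_noiseExponent_nonneg t)
    (S.integrable_rateKernel_mul_noiseExponent t).1, S.lintegral_rateKernel_mul_noiseExponent,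
    ← integral_const_mul, integral_eq_lintegral_of_nonneg_ae _
    ((S.aestronglyMeasurable_correctionIntegrand t).const_mul _)]
  filter_upwards [S.correctionIntegrand_nonneg t] with z hz
  have := Real.Gamma_pos_of_pos (show 0 < 1 + S.α / 2 by positivity)
  exact mul_nonneg this.le hz

lemma noiseLevel_nonneg (S : MultiTier T) {lam p σ2 : ℝ} (hlam : 0 < lam) (hp : 0 < p)
    (hσ : 0 ≤ σ2) (t : Fin T) : 0 ≤ S.noiseLevel lam p σ2 t := by
  have h1 := S.χ_pos t
  have h2 := S.bandDensity_pos hlam t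
  unfold noiseLevel
  positivity

/-- The high-SNR expression is the first-order Taylor polynomial, in the noise level, of the damped
integral giving the rate. -/
lemma highSNRRate_eq (S : MultiTier T) (lam p σ2 : ℝ) (t : Fin T) :
    S.highSNRRate lam (p / σ2) t = ∫ e, S.rateKernel t e ∂quadrant -
      S.noiseLevel lam p σ2 t * ∫ e, S.rateKernel t e * S.noiseExponent e ∂quadrant := by
  rw [S.integral_rateKernel, S.integral_rateKernel_mul_noiseExponent, highSNRRate, noiseLevel,
    bandDensity, show 1 / (S.χ t * (p / σ2)) = σ2 / (S.χ t * p) by rw [← mul_div_assoc, one_div_div]]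
  ring

variable {S : MultiTier T} {lam : ℝ} {Ω : Type*} [MeasurableSpace Ω] {P : Measure Ω}
  {D : Deployment T S.F Ω}

/-- Closed form of the average rate. -/
theorem IsRealization.avgRate_eq [IsProbabilityMeasure P] (h : S.IsRealization lam P D)
    (hlam : 0 < lam) {p : ℝ} (hp : 0 < p) {σ2 : ℝ} (hσ : 0 ≤ σ2) (t : Fin T) :
    S.avgRate lam p σ2 t P D = ENNReal.ofReal (∫ e, S.rateKernel t e *
      Real.exp (-(S.noiseLevel lam p σ2 t * S.noiseExponent e)) ∂quadrant) := by
  have hχ := S.χ_pos t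
  have hκ := S.κ_pos t
  have hF := S.F_pos t
  have hA := S.bandDensity_pos hlam t
  have hs := S.noiseLevel_nonneg hlam hp hσ t
  set A := S.bandDensity lam t with hAdef
  rw [ofReal_integral_eq_lintegral_ofReal (integrable_mul_exp_neg (S.integrable_rateKernel t)
    S.measurable_noiseExponent.aestronglyMeasurable S.noiseExponent_nonneg hs) (by
      filter_upwards [S.rateKernel_nonneg t] with e he using mul_nonneg he (Real.exp_nonneg _)),
    quadrant, lintegral_prod (fun e => ENNReal.ofReal (S.rateKernel t e *
      Real.exp (-(S.noiseLevel lam p σ2 t * S.noiseExponent e)))) (AEMeasurable.ennreal_ofReal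
      ((S.aemeasurable_rateKernel t).mul (S.measurable_noiseExponent.const_mul _).neg.exp.aemeasurable))]
  -- The measurable version `f` of `Ztilde` is used so that the integrals over `ξ` and `z` can be
  -- exchanged.
  obtain ⟨f, hf, hfZ⟩ := S.exists_measurable_eq_Ztilde t
  have := (S.serving_law t).isProb
  have hM := measurable_mgfNeg (S.serving t)
  have h1 : ∀ ξ ∈ Ioi (0 : ℝ), ENNReal.ofReal (2 * Real.pi * (S.κ t * lam) * ξ *
      Real.exp (-(Real.pi * ∑ q, S.κ q * lam * S.biasRatio t q ^ (2 / S.α) * ξ ^ 2))) *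
      S.condRate p σ2 t ξ P D = ∫⁻ z in Ioi (0 : ℝ),
        ENNReal.ofReal ((1 - mgfNeg (S.serving t) z) / z) * ENNReal.ofReal (2 * A * ξ *
          Real.exp (-(z * σ2 / (S.χ t * p) * ξ ^ S.α) - A * f z * ξ ^ 2)) := by
    intro ξ hξ
    have hξ : 0 < ξ := hξ
    rw [h.condRate_eq hlam hp hσ t hξ, ← mul_assoc, ← ENNReal.ofReal_natCast,
      ← ENNReal.ofReal_inv_of_pos hF, ← ENNReal.ofReal_mul (by positivity),
      ← lintegral_const_mul' _ _ ENNReal.ofReal_ne_top]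
    refine setLIntegral_congr_fun measurableSet_Ioi fun z hz => ?_
    have hz : 0 < z := hz
    rw [mul_left_comm, ← ENNReal.ofReal_mul (by positivity), ← hfZ z hz]
    congr 2
    -- `C` is the association exponent; it cancels against the `+ C` in the conditional rate.
    set C := Real.pi * ∑ q, S.κ q * lam * S.biasRatio t q ^ (2 / S.α) * ξ ^ 2
    have he : Real.exp (-(z * σ2 / (S.χ t * p) * ξ ^ S.α) - A * S.Ztilde t z * ξ ^ 2) =
        Real.exp (-C) * Real.exp (-(z * (ξ ^ S.α / (S.χ t * p)) * σ2) +
          (C - A * S.Ztilde t z * ξ ^ 2)) := by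
      rw [← Real.exp_add]
      congr 1
      ring
    rw [he, hAdef, bandDensity]
    ring
  rw [avgRate, setLIntegral_congr_fun measurableSet_Ioi h1, lintegral_lintegral_swap]
  · refine setLIntegral_congr_fun measurableSet_Ioi fun z hz => ?_
    have hz : 0 < z := hz
    have hM1 := (S.serving_law t).mgfNeg_le_one hz.le
    have h0 : 0 ≤ (1 - mgfNeg (S.serving t) z) / z := div_nonneg (by linarith) hz.le
    rw [lintegral_const_mul' _ _ ENNReal.ofReal_ne_top, lintegral_rate_substitution hA,
      ← lintegral_const_mul' _ _ ENNReal.ofReal_ne_top]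
    refine lintegral_congr fun u => ?_
    rw [← ENNReal.ofReal_mul h0]
    simp only [rateKernel, noiseExponent, noiseLevel, hfZ z hz]
    rw [mul_assoc _ (Real.exp _), ← Real.exp_add, hAdef]
    congr 3
    ring
  · refine Measurable.aemeasurable ?_
    refine Measurable.mul (ENNReal.measurable_ofReal.comp ((measurable_const.sub
      (hM.comp measurable_snd)).div measurable_snd)) (ENNReal.measurable_ofReal.comp ?_)
    refine Measurable.mul (by fun_prop) (Measurable.exp (Measurable.sub (by fun_prop) ?_))
    exact ((hf.comp measurable_snd).const_mul A).mul (by fun_prop)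

lemma IsRealization.toReal_avgRate [IsProbabilityMeasure P] (h : S.IsRealization lam P D)
    (hlam : 0 < lam) {p : ℝ} (hp : 0 < p) {σ2 : ℝ} (hσ : 0 ≤ σ2) (t : Fin T) :
    (S.avgRate lam p σ2 t P D).toReal = ∫ e, S.rateKernel t e *
      Real.exp (-(S.noiseLevel lam p σ2 t * S.noiseExponent e)) ∂quadrant := by
  rw [h.avgRate_eq hlam hp hσ, ENNReal.toReal_ofReal]
  refine integral_nonneg_of_ae ?_
  filter_upwards [S.rateKernel_nonneg t] with e he using mul_nonneg he (Real.exp_nonneg _)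

lemma tendsto_noiseLevel_zero (S : MultiTier T) {lam p : ℝ} (hlam : 0 < lam) (hp : 0 < p)
    (t : Fin T) : Tendsto (fun σ2 => S.noiseLevel lam p σ2 t) (𝓝[>] 0) (𝓝[>] 0) := by
  have h1 := S.χ_pos t
  have h2 := S.bandDensity_pos hlam t
  refine tendsto_nhdsWithin_iff.2 ⟨?_, ?_⟩
  · have : Continuous fun σ2 => S.noiseLevel lam p σ2 t := by
      unfold noiseLevel
      fun_prop
    have := (this.tendsto 0).mono_left (nhdsWithin_le_nhds (s := Ioi 0))
    simpa [noiseLevel] using this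
  · filter_upwards [self_mem_nhdsWithin] with σ2 hσ
    have hσ : 0 < σ2 := hσ
    simp only [noiseLevel, mem_Ioi]
    positivity

/-- The band density is linear in `lam`, so the noise level decays like `lam^(-α/2)`; it is
identically `0` when `σ2 = 0`. -/
lemma tendsto_noiseLevel_atTop (S : MultiTier T) {p σ2 : ℝ} (hp : 0 < p) (hσ : 0 ≤ σ2)
    (t : Fin T) : Tendsto (fun lam => S.noiseLevel lam p σ2 t) atTop (𝓝[≥] 0) := by
  refine tendsto_nhdsWithin_iff.2 ⟨?_, ?_⟩
  · have h1 : Tendsto (fun lam => S.bandDensity lam t) atTop atTop := by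
      have : Tendsto (fun lam : ℝ => Real.pi * (S.κ t / S.F t) * lam) atTop atTop :=
        tendsto_id.const_mul_atTop (mul_pos Real.pi_pos (div_pos (S.κ_pos t) (S.F_pos t)))
      refine this.congr fun lam => ?_
      rw [bandDensity]
      ring
    have h2 := (tendsto_rpow_neg_atTop (half_pos S.α_pos)).comp h1
    have := h2.const_mul (σ2 / (S.χ t * p))
    simpa [noiseLevel] using this
  · filter_upwards [eventually_gt_atTop 0] with lam hlam using S.noiseLevel_nonneg hlam hp hσ t

end MultiTier

end

/-! ### Limits, bounds and expansion of the rate -/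

theorem corollary9 {T : ℕ} (S : MultiTier T) {Ω : Type*} [MeasurableSpace Ω]
    (P : Measure Ω) [IsProbabilityMeasure P] (D : ℝ → Deployment T S.F Ω)
    (hD : ∀ lam : ℝ, 0 < lam → S.IsRealization lam P (D lam))
    (p : ℝ) (hp : 0 < p) (t : Fin T) :
    -- the series and the integrals in the formulas converge
    (∀ q : Fin T, ∀ y : ℝ, 0 < y → Summable (TcalTerm S.α (S.interf q) y)) ∧
    IntegrableOn (S.limitIntegrand t) (Ioi 0) ∧
    IntegrableOn (S.correctionIntegrand t) (Ioi 0) ∧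
    -- the rate is finite, and bounded from above by the limit
    (∀ lam σ2 : ℝ, 0 < lam → 0 ≤ σ2 → S.avgRate lam p σ2 t P (D lam) < ∞) ∧
    (∀ lam σ2 : ℝ, 0 < lam → 0 ≤ σ2 →
      (S.avgRate lam p σ2 t P (D lam)).toReal ≤ S.limitRate t) ∧
    -- the interference-limited rate: zero noise, and limit of infinite SNR
    (∀ lam : ℝ, 0 < lam → (S.avgRate lam p 0 t P (D lam)).toReal = S.limitRate t) ∧
    (∀ lam : ℝ, 0 < lam →
      Tendsto (fun σ2 : ℝ => (S.avgRate lam p σ2 t P (D lam)).toReal) (𝓝[>] 0)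
        (𝓝 (S.limitRate t))) ∧
    -- the dense-network limit is the same
    (∀ σ2 : ℝ, 0 ≤ σ2 →
      Tendsto (fun lam : ℝ => (S.avgRate lam p σ2 t P (D lam)).toReal) atTop
        (𝓝 (S.limitRate t))) ∧
    -- the high-SNR expression is a lower bound, exact up to an error `o(1 / SNR)`
    (∀ lam σ2 : ℝ, 0 < lam → 0 < σ2 →
      S.highSNRRate lam (p / σ2) t ≤ (S.avgRate lam p σ2 t P (D lam)).toReal) ∧
    (∀ lam : ℝ, 0 < lam →
      (fun σ2 : ℝ => (S.avgRate lam p σ2 t P (D lam)).toReal - S.highSNRRate lam (p / σ2) t)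
        =o[𝓝[>] 0] (fun σ2 : ℝ => 1 / (p / σ2))) := by
  have hker := S.integrable_rateKernel t
  have hker0 := S.rateKernel_nonneg t
  have hx := S.measurable_noiseExponent.aestronglyMeasurable (μ := MultiTier.quadrant)
  have hx0 := S.noiseExponent_nonneg
  have hkerx := S.integrable_rateKernel_mul_noiseExponent t
  refine ⟨fun q y hy => (S.interf_law q).summable_TcalTerm S.two_lt_α hy,
    S.integrableOn_limitIntegrand t, S.integrableOn_correctionIntegrand t, ?_, ?_, ?_, ?_, ?_, ?_, ?_⟩
  · intro lam σ2 hlam hσ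
    rw [(hD lam hlam).avgRate_eq hlam hp hσ]
    exact ENNReal.ofReal_lt_top
  · intro lam σ2 hlam hσ
    rw [(hD lam hlam).toReal_avgRate hlam hp hσ, ← S.integral_rateKernel t]
    exact integral_mul_exp_neg_le hker hker0 hx hx0 (S.noiseLevel_nonneg hlam hp hσ t)
  · intro lam hlam
    rw [(hD lam hlam).toReal_avgRate hlam hp le_rfl, ← S.integral_rateKernel t]
    simp [MultiTier.noiseLevel]
  · intro lam hlam
    rw [← S.integral_rateKernel t]
    refine ((tendsto_integral_mul_exp_neg hker hx hx0).comp
      ((S.tendsto_noiseLevel_zero hlam hp t).mono_right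
        (nhdsWithin_mono 0 Ioi_subset_Ici_self))).congr' ?_
    filter_upwards [self_mem_nhdsWithin] with σ2 hσ
    exact ((hD lam hlam).toReal_avgRate hlam hp (le_of_lt hσ) t).symm
  · intro σ2 hσ
    rw [← S.integral_rateKernel t]
    refine ((tendsto_integral_mul_exp_neg hker hx hx0).comp
      (S.tendsto_noiseLevel_atTop hp hσ t)).congr' ?_
    filter_upwards [eventually_gt_atTop 0] with lam hlam
    exact ((hD lam hlam).toReal_avgRate hlam hp hσ t).symm
  · intro lam σ2 hlam hσ
    rw [(hD lam hlam).toReal_avgRate hlam hp hσ.le, S.highSNRRate_eq]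
    exact le_integral_mul_exp_neg hker hker0 hx hx0 hkerx (S.noiseLevel_nonneg hlam hp hσ.le t)
  · intro lam hlam
    have hlim := (tendsto_integral_mul_exp_neg_sub_div hker hx hx0 hkerx).comp
      (S.tendsto_noiseLevel_zero hlam hp t)
    -- The constant is the ratio of the noise level to `1 / SNR = σ2 / p`; it converts `o(noise
    -- level)` into `o(1 / SNR)`.
    have hC := (hlim.mul_const (1 / S.χ t * S.bandDensity lam t ^ (-(S.α / 2))))
    rw [zero_mul] at hC
    refine (isLittleO_iff_tendsto' ?_).2 (hC.congr' ?_)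
    · filter_upwards [self_mem_nhdsWithin] with σ2 hσ h0
      have hσ : 0 < σ2 := hσ
      have : 0 < 1 / (p / σ2) := by positivity
      exact absurd h0 this.ne'
    · filter_upwards [self_mem_nhdsWithin] with σ2 hσ
      have hσ : 0 < σ2 := hσ
      have hχ := S.χ_pos t
      have hA := Real.rpow_pos_of_pos (S.bandDensity_pos hlam t) (-(S.α / 2))
      rw [(hD lam hlam).toReal_avgRate hlam hp hσ.le, S.highSNRRate_eq]
      simp only [Function.comp_apply]
      set N := (∫ e, S.rateKernel t e *
        Real.exp (-(S.noiseLevel lam p σ2 t * S.noiseExponent e)) ∂MultiTier.quadrant) -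
        (∫ e, S.rateKernel t e ∂MultiTier.quadrant - S.noiseLevel lam p σ2 t *
          ∫ e, S.rateKernel t e * S.noiseExponent e ∂MultiTier.quadrant)
      rw [MultiTier.noiseLevel]
      field_simp
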